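/- Let $K$ be a field, let $\iota\colon N\to M$ be a homomorphism of unital associative $K$-algebras (an algebra extension $M|N$), and write $n$ for $\iota(n)$. Let $R=C_M(N)$ be the centralizer of $N$ in $M$, $A=\mathrm{End}({}_NM_N)$ the $K$-algebra of $N$-$N$-bimodule endomorphisms of $M$ under composition, and $B=(M\otimes_N M)^N$ the space of elements $b=b^1\otimes b^2$ (summation suppressed) of $M\otimes_NM$ with $nb=bn$ for all $n\in N$, a $K$-algebra with multiplication $bb'=b'^1b^1\otimes b^2b'^2$ and unit $1\otimes 1$. For $r\in R$ let $\lambda(r),\rho(r)\in A$ be left and right multiplication by $r$. Assume: * $M|N$ has depth two: ${}_NM\otimes_NM_M$ is isomorphic to a direct summand of ${}_N(M^s)_M$ for some $s\ge 1$, and ${}_MM\otimes_NM_N$ is isomorphic to a direct summand of ${}_M(M^{s'})_N$ for some $s'\ge 1$; * $M|N$ is Frobenius: there is a Frobenius homomorphism, i.e. an $N$-$N$-bimodule map $E\colon M\to N$ with $x_i,y_i\in M$ (finitely many) such that $\sum_i x_iE(y_im)=m=\sum_iE(mx_i)y_i$ for all $m\in M$; * $R$ is a separable $K$-algebra: there is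 $z\in R\otimes_KR$ with $rz=zr$ for all $r\in R$ whose image under multiplication is $1$. Call finite families $b_i\in B$, $\beta_i\in A$ a left quasibasis if $\sum_i b_i^1\otimes b_i^2\beta_i(m)=m\otimes 1$ for all $m\in M$. Call a $K$-linear map $\phi\colon R\to K$ with finite families $e_j,f_j\in R$ index-one Frobenius coordinates of $R$ if $\sum_j\phi(re_j)f_j=r=\sum_je_j\phi(f_jr)$ for all $r\in R$ and $\sum_je_jf_j=1$. Theorem. $A$ and $B$ are finite-dimensional over $K$; left quasibases exist; and index-one Frobenius coordinates of $R$ exist. For all index-one Frobenius coordinates $(\phi,e_j,f_j)$ of $R$, there are weak Hopf algebra structures on the $K$-algebras $A$ and $B$ such that 1. for every left quasibasis $(b_i,\beta_i)$, the coproducts are $$\Delta(a)=\sum_{i,j}a(-\,b_i^1)b_i^2e_j\otimes_K\lambda(f_j)\beta_i,\qquad \Delta(b)=\sum_{i,j}(b_i^1\otimes_N b_i^2e_j)\otimes_K(f_j\beta_i(b^1)\otimes_N b^2),$$ and the counits are $\varepsilon(a)=\phi(a(1))$ and $\varepsilon(b)=\phi(b^1b^2)$, for $a\in A$, $b\in B$;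 2. $A$ and $B$ are dual to one another as weak Hopf algebras through $\langle b,a\rangle=\phi(b^1a(b^2))$. That is, this $K$-bilinear form induces bijections $B\to\mathrm{Hom}_K(A,K)$ and $A\to\mathrm{Hom}_K(B,K)$ and satisfies $\langle bb',a\rangle=\langle b,a_{(1)}\rangle\langle b',a_{(2)}\rangle$, $\langle b,aa'\rangle=\langle b_{(1)},a\rangle\langle b_{(2)},a'\rangle$, $\langle 1,a\rangle=\varepsilon(a)$, $\langle b,1\rangle=\varepsilon(b)$ and $\langle S(b),a\rangle=\langle b,S(a)\rangle$, where $S$ denotes the antipodes; 3. every Frobenius homomorphism $E$ of $M|N$, regarded as the element $\iota\circ E$ of $A$, is a nondegenerate left integral: $aE=\Pi^L(a)E$ for all $a\in A$, where $\Pi^L(a)=\varepsilon(1_{(1)}a)1_{(2)}$, and the maps $g\mapsto g(E_{(1)})E_{(2)}$ and $g\mapsto E_{(1)}g(E_{(2)})$ from $\mathrm{Hom}_K(A,K)$ to $A$ are bijective. Here a weak Hopf algebra is a $K$-algebra and $K$-coalgebra $H$ with $\Delta(xy)=\Delta(x)\Delta(y)$, $(\Delta(1)\otimes1)(1\otimes\Delta(1))=(1\otimes\Delta(1))(\Delta(1)\otimes1)=(\mathrm{id}\otimes\Delta)\Delta(1)$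 and $\varepsilon(xyz)=\varepsilon(xy_{(1)})\varepsilon(y_{(2)}z)=\varepsilon(xy_{(2)})\varepsilon(y_{(1)}z)$, together with a $K$-linear antipode $S\colon H\to H$ such that $x_{(1)}S(x_{(2)})=\varepsilon(1_{(1)}x)1_{(2)}$, $S(x_{(1)})x_{(2)}=1_{(1)}\varepsilon(x1_{(2)})$ and $S(x_{(1)})x_{(2)}S(x_{(3)})=S(x)$. -/

import Mathlib

open scoped TensorProduct

namespace DepthTwo

/-! Weak bialgebras and weak Hopf algebras -/

section WeakHopf

/-- A weak bialgebra over `K`: an algebra and a coalgebra with multiplicative coproduct,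
weakly comultiplicative unit and weakly multiplicative counit. -/
class WeakBialgebra (K : Type*) (H : Type*) [Field K] [Ring H] [Algebra K H] extends
    Coalgebra K H where
  comul_mul : ∀ a b : H, comul (a * b) = comul a * comul b
  /-- `(Δ(1) ⊗ 1)(1 ⊗ Δ(1)) = Δ²(1)` -/
  comul_one_left :
    TensorProduct.assoc K H H H (comul 1 ⊗ₜ[K] 1) * ((1 : H) ⊗ₜ[K] comul 1) =
      comul.lTensor H (comul 1)
  /-- `(1 ⊗ Δ(1))(Δ(1) ⊗ 1) = Δ²(1)` -/
  comul_one_right :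
    ((1 : H) ⊗ₜ[K] comul 1) * TensorProduct.assoc K H H H (comul 1 ⊗ₜ[K] 1) =
      comul.lTensor H (comul 1)
  /-- `ε(abc) = ε(a b₍₁₎) ε(b₍₂₎ c)` -/
  counit_mul_left : ∀ a b c : H, counit (a * b * c) =
    LinearMap.mul' K K (TensorProduct.map (counit ∘ₗ LinearMap.mulLeft K a)
      (counit ∘ₗ LinearMap.mulRight K c) (comul b))
  /-- `ε(abc) = ε(a b₍₂₎) ε(b₍₁₎ c)` -/
  counit_mul_right : ∀ a b c : H, counit (a * b * c) =
    LinearMap.mul' K K (TensorProduct.map (counit ∘ₗ LinearMap.mulRight K c)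
      (counit ∘ₗ LinearMap.mulLeft K a) (comul b))

/-- `Π^L(x) = ε(1₍₁₎ x) 1₍₂₎` -/
def targetProj (K : Type*) {H : Type*} [Field K] [Ring H] [Algebra K H] [WeakBialgebra K H]
    (x : H) : H :=
  TensorProduct.lid K H (TensorProduct.map
    ((Coalgebra.counit : H →ₗ[K] K) ∘ₗ LinearMap.mulRight K x) LinearMap.id
    (Coalgebra.comul (R := K) (1 : H)))

/-- `Π^R(x) = 1₍₁₎ ε(x 1₍₂₎)` -/
def sourceProj (K : Type*) {H : Type*} [Field K] [Ring H] [Algebra K H] [WeakBialgebra K H]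
    (x : H) : H :=
  TensorProduct.rid K H (TensorProduct.map LinearMap.id
    ((Coalgebra.counit : H →ₗ[K] K) ∘ₗ LinearMap.mulLeft K x)
    (Coalgebra.comul (R := K) (1 : H)))

/-- A weak Hopf algebra: a weak bialgebra with an antipode. -/
class WeakHopfAlgebra (K : Type*) (H : Type*) [Field K] [Ring H] [Algebra K H] extends
    WeakBialgebra K H where
  antipode : H →ₗ[K] H
  /-- `x₍₁₎ S(x₍₂₎) = Π^L(x)` -/
  mul_antipode : ∀ x : H,
    LinearMap.mul' K H (antipode.lTensor H (comul x)) = targetProj K x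
  /-- `S(x₍₁₎) x₍₂₎ = Π^R(x)` -/
  antipode_mul : ∀ x : H,
    LinearMap.mul' K H (antipode.rTensor H (comul x)) = sourceProj K x
  /-- `S(x₍₁₎) x₍₂₎ S(x₍₃₎) = S(x)` -/
  antipode_mul_antipode : ∀ x : H,
    LinearMap.mul' K H (TensorProduct.map antipode
      (LinearMap.mul' K H ∘ₗ antipode.lTensor H ∘ₗ comul) (comul x)) = antipode x

/-- `l` is a left integral: `a l = Π^L(a) l` for all `a`. -/
def IsLeftIntegral (K : Type*) {H : Type*} [Field K] [Ring H] [Algebra K H]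
    [WeakBialgebra K H] (l : H) : Prop :=
  ∀ a : H, a * l = targetProj K a * l

/-- `l` is nondegenerate: both maps from the linear dual of `H` to `H`,
`g ↦ g(l₍₁₎) l₍₂₎` and `g ↦ l₍₁₎ g(l₍₂₎)`, are bijective. -/
def IsNondegenerate (K : Type*) {H : Type*} [Field K] [Ring H] [Algebra K H]
    [WeakBialgebra K H] (l : H) : Prop :=
  Function.Bijective (fun g : H →ₗ[K] K =>
    TensorProduct.lid K H (g.rTensor H (Coalgebra.comul (R := K) l))) ∧
  Function.Bijective (fun g : H →ₗ[K] K =>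
    TensorProduct.rid K H (g.lTensor H (Coalgebra.comul (R := K) l)))

/-- The bilinear form `p` exhibits the weak Hopf algebras `H'` and `H` as dual to one another. -/
structure IsDualPairing {K H' H : Type*} [Field K] [Ring H'] [Algebra K H'] [Ring H] [Algebra K H]
    [WeakHopfAlgebra K H'] [WeakHopfAlgebra K H] (p : H' →ₗ[K] H →ₗ[K] K) : Prop where
  bijective_left : Function.Bijective p
  bijective_right : Function.Bijective p.flip
  /-- `⟨b b', a⟩ = ⟨b, a₍₁₎⟩ ⟨b', a₍₂₎⟩` -/
  mul_left : ∀ (b b' : H') (a : H), p (b * b') a =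
    LinearMap.mul' K K (TensorProduct.map (p b) (p b') (Coalgebra.comul (R := K) a))
  /-- `⟨b, a a'⟩ = ⟨b₍₁₎, a⟩ ⟨b₍₂₎, a'⟩` -/
  mul_right : ∀ (b : H') (a a' : H), p b (a * a') =
    LinearMap.mul' K K (TensorProduct.map (p.flip a) (p.flip a') (Coalgebra.comul (R := K) b))
  one_left : ∀ a : H, p 1 a = Coalgebra.counit (R := K) a
  one_right : ∀ b : H', p b 1 = Coalgebra.counit (R := K) b
  antipode : ∀ (b : H') (a : H),
    p (WeakHopfAlgebra.antipode (K := K) b) a = p b (WeakHopfAlgebra.antipode (K := K) a)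

end WeakHopf

/-! Separable algebras and index-one Frobenius coordinates -/

section Separable

/-- A `K`-algebra is separable if it has a separability idempotent. -/
def IsSeparableAlgebra (K R : Type*) [Field K] [Ring R] [Algebra K R] : Prop :=
  ∃ z : R ⊗[K] R, LinearMap.mul' K R z = 1 ∧
    ∀ r : R, (r ⊗ₜ[K] (1 : R)) * z = z * ((1 : R) ⊗ₜ[K] r)

/-- `φ, e, f` is a system of index-one Frobenius coordinates for the `K`-algebra `R`. -/
structure IsIndexOneFrobenius {K R : Type*} [Field K] [Ring R] [Algebra K R] {s : ℕ}
    (φ : R →ₗ[K] K) (e f : Fin s → R) : Prop where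
  left : ∀ r : R, ∑ j, φ (r * e j) • f j = r
  right : ∀ r : R, ∑ j, φ (f j * r) • e j = r
  index_one : ∑ j, e j * f j = 1

end Separable

section Extension

variable {K N M : Type*} [Field K] [Ring N] [Algebra K N] [Ring M] [Algebra K M]

/-- The relations `m n ⊗ m' = m ⊗ n m'`. -/
def balancedRel (ι : N →ₐ[K] M) : Submodule K (M ⊗[K] M) :=
  Submodule.span K {z | ∃ (m : M) (n : N) (m' : M),
    z = (m * ι n) ⊗ₜ[K] m' - m ⊗ₜ[K] (ι n * m')}

/-- The tensor square `M ⊗_N M` of the extension `ι : N → M`. As `K` acts through `N`, it is the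
quotient of `M ⊗_K M` by the `N`-balancing relations. -/
abbrev TensorSq (ι : N →ₐ[K] M) : Type _ := (M ⊗[K] M) ⧸ balancedRel ι

/-- The element `m ⊗_N m'`. -/
def tmul (ι : N →ₐ[K] M) (m m' : M) : TensorSq ι := (balancedRel ι).mkQ (m ⊗ₜ[K] m')

theorem tmul_add_left (ι : N →ₐ[K] M) (m m' x : M) :
    tmul ι (m + m') x = tmul ι m x + tmul ι m' x := by
  simp [tmul, TensorProduct.add_tmul]

theorem tmul_add_right (ι : N →ₐ[K] M) (m x x' : M) :
    tmul ι m (x + x') = tmul ι m x + tmul ι m x' := by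
  simp [tmul, TensorProduct.tmul_add]

theorem tmul_smul_left (ι : N →ₐ[K] M) (k : K) (m x : M) :
    tmul ι (k • m) x = k • tmul ι m x := by
  rw [tmul, tmul, ← map_smul, TensorProduct.smul_tmul']

theorem tmul_smul_right (ι : N →ₐ[K] M) (k : K) (m x : M) :
    tmul ι m (k • x) = k • tmul ι m x := by
  simp [tmul]

theorem tmul_balanced (ι : N →ₐ[K] M) (m : M) (n : N) (m' : M) :
    tmul ι (m * ι n) m' = tmul ι m (ι n * m') := by
  unfold tmul
  rw [← sub_eq_zero, ← map_sub, Submodule.mkQ_apply, Submodule.Quotient.mk_eq_zero]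
  exact Submodule.subset_span ⟨m, n, m', rfl⟩

theorem tensorSq_ext {P : Type*} [AddCommGroup P] [Module K P] (ι : N →ₐ[K] M)
    {g h : TensorSq ι →ₗ[K] P} (H : ∀ m m', g (tmul ι m m') = h (tmul ι m m')) : g = h := by
  refine Submodule.linearMap_qext _ (TensorProduct.ext' fun m m' => ?_)
  exact H m m'

/-- The linear map on `M ⊗_N M` induced by an `N`-balanced bilinear map. -/
def liftSq {P : Type*} [AddCommGroup P] [Module K P] (ι : N →ₐ[K] M) (g : M →ₗ[K] M →ₗ[K] P)
    (hg : ∀ m n m', g (m * ι n) m' = g m (ι n * m')) : TensorSq ι →ₗ[K] P :=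
  (balancedRel ι).liftQ (TensorProduct.lift g) (by
    rw [balancedRel, Submodule.span_le]
    rintro _ ⟨m, n, m', rfl⟩
    simp [hg])

@[simp] theorem liftSq_tmul {P : Type*} [AddCommGroup P] [Module K P] (ι : N →ₐ[K] M)
    (g : M →ₗ[K] M →ₗ[K] P) (hg : ∀ m n m', g (m * ι n) m' = g m (ι n * m')) (m m' : M) :
    liftSq ι g hg (tmul ι m m') = g m m' := by
  simp [liftSq, tmul]

/-- The natural bilinear map `M × M → M ⊗_N M`. -/
def tmulBilin (ι : N →ₐ[K] M) : M →ₗ[K] M →ₗ[K] TensorSq ι :=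
  (TensorProduct.mk K M M).compr₂ (balancedRel ι).mkQ

@[simp] theorem tmulBilin_apply (ι : N →ₐ[K] M) (m m' : M) :
    tmulBilin ι m m' = tmul ι m m' := rfl

/-- The `M`-`M`-bimodule structure `x ⊗ y ↦ m x ⊗ y m'` of `M ⊗_N M`. -/
def bimul (ι : N →ₐ[K] M) (m m' : M) : TensorSq ι →ₗ[K] TensorSq ι :=
  liftSq ι ((tmulBilin ι).compl₁₂ (LinearMap.mulLeft K m) (LinearMap.mulRight K m'))
    (fun x n y => by
      simp only [LinearMap.compl₁₂_apply, LinearMap.mulLeft_apply, LinearMap.mulRight_apply,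
        tmulBilin_apply, ← mul_assoc, tmul_balanced])

@[simp] theorem bimul_tmul (ι : N →ₐ[K] M) (m m' x y : M) :
    bimul ι m m' (tmul ι x y) = tmul ι (m * x) (y * m') := by
  exact liftSq_tmul ι _ _ x y

theorem bimul_bimul (ι : N →ₐ[K] M) (m m' x x' : M) (b : TensorSq ι) :
    bimul ι m m' (bimul ι x x' b) = bimul ι (m * x) (x' * m') b := by
  have : bimul ι m m' ∘ₗ bimul ι x x' = bimul ι (m * x) (x' * m') :=
    tensorSq_ext ι fun p q => by simp [mul_assoc]
  exact LinearMap.congr_fun this b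

/-- The centralizer `R = M^N`. -/
abbrev R (ι : N →ₐ[K] M) : Subalgebra K M := Subalgebra.centralizer K (Set.range ι)

/-- The `N`-`N`-bimodule endomorphisms of `M`, as a subalgebra of the `K`-linear ones. -/
def bimoduleEnd (ι : N →ₐ[K] M) : Subalgebra K (Module.End K M) where
  carrier := {a | ∀ (n n' : N) (m : M), a (ι n * m * ι n') = ι n * a m * ι n'}
  mul_mem' := fun {a b} ha hb n n' m => by
    rw [Module.End.mul_apply, hb, ha, Module.End.mul_apply]
  add_mem' := fun {a b} ha hb n n' m => by
    rw [LinearMap.add_apply, ha, hb, LinearMap.add_apply, mul_add, add_mul]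
  algebraMap_mem' := fun k n n' m => by
    simp [Module.algebraMap_end_apply]

/-- The algebra `A = End(_N M_N)` of `N`-`N`-bimodule endomorphisms of `M` under composition. -/
def A (ι : N →ₐ[K] M) : Type _ := bimoduleEnd ι

instance instRingA (ι : N →ₐ[K] M) : Ring (A ι) := inferInstanceAs (Ring (bimoduleEnd ι))

instance instAlgebraA (ι : N →ₐ[K] M) : Algebra K (A ι) :=
  inferInstanceAs (Algebra K (bimoduleEnd ι))

@[simp] theorem A_add_val {ι : N →ₐ[K] M} (a a' : A ι) : (a + a').1 = a.1 + a'.1 := rfl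

@[simp] theorem A_smul_val {ι : N →ₐ[K] M} (k : K) (a : A ι) : (k • a).1 = k • a.1 := rfl

/-- The space `B = (M ⊗_N M)^N` of `N`-central elements of `M ⊗_N M`. -/
def B (ι : N →ₐ[K] M) : Submodule K (TensorSq ι) where
  carrier := {b | ∀ n : N, bimul ι (ι n) 1 b = bimul ι 1 (ι n) b}
  add_mem' := fun {a b} ha hb n => by rw [map_add, map_add, ha, hb]
  zero_mem' := fun n => by rw [map_zero, map_zero]
  smul_mem' := fun k b hb n => by rw [map_smul, map_smul, hb]

theorem A_left {ι : N →ₐ[K] M} (a : A ι) (n : N) (m : M) : a.1 (ι n * m) = ι n * a.1 m := by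
  simpa using a.2 n 1 m

theorem A_right {ι : N →ₐ[K] M} (a : A ι) (n : N) (m : M) : a.1 (m * ι n) = a.1 m * ι n := by
  simpa using a.2 1 n m

theorem R_comm {ι : N →ₐ[K] M} (r : R ι) (n : N) : ι n * r.1 = r.1 * ι n :=
  (Subalgebra.mem_centralizer_iff K).1 r.2 _ ⟨n, rfl⟩

/-- The map `x ⊗ y ↦ x b¹ ⊗ b² y` of `M ⊗_N M` given by `b ∈ B`. -/
def actB {ι : N →ₐ[K] M} (b : B ι) : TensorSq ι →ₗ[K] TensorSq ι :=
  liftSq ι (LinearMap.mk₂ K (fun x y => bimul ι x y b.1)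
    (fun x x' y => by
      have : bimul ι (x + x') y = bimul ι x y + bimul ι x' y :=
        tensorSq_ext ι fun p q => by simp [add_mul, tmul_add_left]
      rw [this]; rfl)
    (fun k x y => by
      have : bimul ι (k • x) y = k • bimul ι x y :=
        tensorSq_ext ι fun p q => by simp [tmul_smul_left]
      rw [this]; rfl)
    (fun x y y' => by
      have : bimul ι x (y + y') = bimul ι x y + bimul ι x y' :=
        tensorSq_ext ι fun p q => by simp [mul_add, tmul_add_right]
      rw [this]; rfl)
    (fun k x y => by
      have : bimul ι x (k • y) = k • bimul ι x y :=
        tensorSq_ext ι fun p q => by simp [tmul_smul_right]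
      rw [this]; rfl))
    (fun m n m' => by
      have h := congrArg (bimul ι m m') (b.2 n)
      simpa [bimul_bimul] using h)

@[simp] theorem actB_tmul {ι : N →ₐ[K] M} (b : B ι) (x y : M) :
    actB b (tmul ι x y) = bimul ι x y b.1 := by
  simp [actB]

theorem actB_bimul {ι : N →ₐ[K] M} (b : B ι) (m m' : M) (z : TensorSq ι) :
    actB b (bimul ι m m' z) = bimul ι m m' (actB b z) := by
  have : actB b ∘ₗ bimul ι m m' = bimul ι m m' ∘ₗ actB b :=
    tensorSq_ext ι fun p q => by simp [bimul_bimul]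
  exact LinearMap.congr_fun this z

theorem bimul_one_one (ι : N →ₐ[K] M) : bimul ι 1 1 = LinearMap.id :=
  tensorSq_ext ι fun p q => by simp

/-- The multiplication `b b' = b'¹ b¹ ⊗ b² b'²` of `B`. -/
instance instMulB (ι : N →ₐ[K] M) : Mul (B ι) :=
  ⟨fun b b' => ⟨actB b b'.1, fun n => by rw [← actB_bimul, b'.2 n, actB_bimul]⟩⟩

theorem B_mul_val {ι : N →ₐ[K] M} (b b' : B ι) : (b * b').1 = actB b b'.1 := rfl

/-- The unit `1 ⊗ 1` of `B`. -/
instance instOneB (ι : N →ₐ[K] M) : One (B ι) :=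
  ⟨⟨tmul ι 1 1, fun n => by simpa using tmul_balanced ι 1 n 1⟩⟩

theorem B_one_val (ι : N →ₐ[K] M) : (1 : B ι).1 = tmul ι 1 1 := rfl

theorem actB_add {ι : N →ₐ[K] M} (b b' : B ι) : actB (b + b') = actB b + actB b' :=
  tensorSq_ext ι fun p q => by simp

theorem actB_smul {ι : N →ₐ[K] M} (k : K) (b : B ι) : actB (k • b) = k • actB b :=
  tensorSq_ext ι fun p q => by simp

theorem actB_mul {ι : N →ₐ[K] M} (b b' : B ι) : actB (b * b') = actB b ∘ₗ actB b' :=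
  tensorSq_ext ι fun p q => by simp [B_mul_val, actB_bimul]

instance instRingB (ι : N →ₐ[K] M) : Ring (B ι) :=
  { (inferInstance : AddCommGroup (B ι)), instMulB ι, instOneB ι with
    left_distrib := fun a b c => Subtype.ext (by simp [B_mul_val])
    right_distrib := fun a b c => Subtype.ext (by simp [B_mul_val, actB_add])
    zero_mul := fun a => Subtype.ext (by
      have h := actB_smul (0 : K) (0 : B ι)
      rw [zero_smul, zero_smul] at h
      simp [B_mul_val, h])
    mul_zero := fun a => Subtype.ext (by simp [B_mul_val])
    mul_assoc := fun a b c => Subtype.ext (by simp [B_mul_val, actB_mul])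
    one_mul := fun a => Subtype.ext (by
      have h : actB (1 : B ι) = LinearMap.id :=
        tensorSq_ext ι fun p q => by simp [B_one_val]
      simp [B_mul_val, h])
    mul_one := fun a => Subtype.ext (by simp [B_mul_val, B_one_val, bimul_one_one]) }

instance instAlgebraB (ι : N →ₐ[K] M) : Algebra K (B ι) :=
  Algebra.ofModule
    (fun k a b => Subtype.ext (by
      change actB (k • a) b.1 = k • actB a b.1
      rw [actB_smul]; rfl))
    (fun k a b => Subtype.ext (by
      change actB a (k • b.1) = k • actB a b.1
      rw [map_smul]))

/-! Depth two and Frobenius extensions -/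

/-- Left depth two: `M ⊗_N M` is a direct summand of a finite power of `M` as an
`N`-`M`-bimodule. -/
def IsLeftDepthTwo (ι : N →ₐ[K] M) : Prop :=
  ∃ s : ℕ, 0 < s ∧ ∃ (p : (Fin s → M) →ₗ[K] TensorSq ι) (q : TensorSq ι →ₗ[K] (Fin s → M)),
    (∀ (n : N) (m : M) (v : Fin s → M), p (fun i => ι n * v i * m) = bimul ι (ι n) m (p v)) ∧
    (∀ (n : N) (m : M) (z : TensorSq ι), q (bimul ι (ι n) m z) = fun i => ι n * q z i * m) ∧
    p ∘ₗ q = LinearMap.id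

/-- Right depth two: `M ⊗_N M` is a direct summand of a finite power of `M` as an
`M`-`N`-bimodule. -/
def IsRightDepthTwo (ι : N →ₐ[K] M) : Prop :=
  ∃ s : ℕ, 0 < s ∧ ∃ (p : (Fin s → M) →ₗ[K] TensorSq ι) (q : TensorSq ι →ₗ[K] (Fin s → M)),
    (∀ (m : M) (n : N) (v : Fin s → M), p (fun i => m * v i * ι n) = bimul ι m (ι n) (p v)) ∧
    (∀ (m : M) (n : N) (z : TensorSq ι), q (bimul ι m (ι n) z) = fun i => m * q z i * ι n) ∧
    p ∘ₗ q = LinearMap.id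

/-- Depth two: both left and right depth two. -/
def IsDepthTwo (ι : N →ₐ[K] M) : Prop := IsLeftDepthTwo ι ∧ IsRightDepthTwo ι

/-- A left depth two quasibasis: `∑ b_i¹ ⊗ b_i² β_i(m) = m ⊗ 1`. -/
def IsLeftQuasibasis {ι : N →ₐ[K] M} {s : ℕ} (b : Fin s → B ι) (β : Fin s → A ι) : Prop :=
  ∀ m : M, ∑ i, bimul ι 1 ((β i).1 m) (b i).1 = tmul ι m 1

/-- `E : M → N` is a Frobenius homomorphism: an `N`-`N`-bimodule map which has dual bases. -/
structure IsFrobeniusHom (ι : N →ₐ[K] M) (E : M →ₗ[K] N) : Prop where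
  bimodule : ∀ (n n' : N) (m : M), E (ι n * m * ι n') = n * E m * n'
  dual_bases : ∃ (s : ℕ) (x y : Fin s → M),
    (∀ m, ∑ i, x i * ι (E (y i * m)) = m) ∧ (∀ m, ∑ i, ι (E (m * x i)) * y i = m)

/-- `M | N` is a Frobenius extension. -/
def IsFrobeniusExtension (ι : N →ₐ[K] M) : Prop := ∃ E : M →ₗ[K] N, IsFrobeniusHom ι E

/-- A Frobenius homomorphism, regarded as an element of `A`. -/
def frobeniusElt {ι : N →ₐ[K] M} {E : M →ₗ[K] N} (hE : IsFrobeniusHom ι E) : A ι :=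
  ⟨ι.toLinearMap ∘ₗ E, fun n n' m => by simp [hE.bimodule]⟩

/-! The structure maps of `A` and `B` -/

/-- `λ(r) : m ↦ r m`, as an element of `A`. -/
def lambda {ι : N →ₐ[K] M} (r : R ι) : A ι :=
  ⟨LinearMap.mulLeft K r.1, fun n n' m => by
    simp only [LinearMap.mulLeft_apply, ← mul_assoc, R_comm]⟩

/-- `ρ(r) : m ↦ m r`, as an element of `A`. -/
def rho {ι : N →ₐ[K] M} (r : R ι) : A ι :=
  ⟨LinearMap.mulRight K r.1, fun n n' m => by
    simp only [LinearMap.mulRight_apply, mul_assoc, R_comm]⟩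

/-- The map `x ⊗ y ↦ g(x) y` for a right `N`-linear endomorphism `g` of `M`. -/
def leftApply {ι : N →ₐ[K] M} (g : Module.End K M) (hg : ∀ m n, g (m * ι n) = g m * ι n) :
    TensorSq ι →ₗ[K] M :=
  liftSq ι ((LinearMap.mul K M).compl₁₂ g LinearMap.id) (fun m n m' => by simp [hg, mul_assoc])

@[simp] theorem leftApply_tmul {ι : N →ₐ[K] M} (g : Module.End K M)
    (hg : ∀ m n, g (m * ι n) = g m * ι n) (x y : M) :
    leftApply g hg (tmul ι x y) = g x * y := by
  simp [leftApply]

/-- The map `x ⊗ y ↦ a(m x) y`. -/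
def coactFun {ι : N →ₐ[K] M} (a : A ι) (m : M) : TensorSq ι →ₗ[K] M :=
  leftApply (a.1 ∘ₗ LinearMap.mulLeft K m) (fun x n => by simp [← mul_assoc, A_right])

@[simp] theorem coactFun_tmul {ι : N →ₐ[K] M} (a : A ι) (m x y : M) :
    coactFun a m (tmul ι x y) = a.1 (m * x) * y := by
  exact leftApply_tmul _ _ x y

theorem coactFun_bimul {ι : N →ₐ[K] M} (a : A ι) (m x y : M) (z : TensorSq ι) :
    coactFun a m (bimul ι x y z) = coactFun a (m * x) z * y := by
  have : coactFun a m ∘ₗ bimul ι x y = LinearMap.mulRight K y ∘ₗ coactFun a (m * x) :=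
    tensorSq_ext ι fun p q => by simp [mul_assoc]
  exact LinearMap.congr_fun this z

/-- The element `a(- b¹) b²` of `A`. -/
def coact {ι : N →ₐ[K] M} (a : A ι) (b : B ι) : A ι :=
  ⟨{ toFun := fun m => coactFun a m b.1
     map_add' := fun m m' => by
      have : coactFun a (m + m') = coactFun a m + coactFun a m' :=
        tensorSq_ext ι fun p q => by simp [add_mul]
      rw [this]; rfl
     map_smul' := fun k m => by
      have : coactFun a (k • m) = k • coactFun a m :=
        tensorSq_ext ι fun p q => by simp
      rw [this]; rfl },
    fun n n' m => by
      have h1 : coactFun a (ι n * m) = LinearMap.mulLeft K (ι n) ∘ₗ coactFun a m :=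
        tensorSq_ext ι fun p q => by simp [mul_assoc, A_left]
      have h2 := congrArg (coactFun a (ι n * m)) (b.2 n')
      simp only [coactFun_bimul, mul_one] at h2
      change coactFun a (ι n * m * ι n') b.1 = ι n * coactFun a m b.1 * ι n'
      rw [h2, h1]; rfl⟩

/-- The map `a ↦ a(1)` from `A` to `R`. -/
def evalOne (ι : N →ₐ[K] M) : A ι →ₗ[K] R ι where
  toFun a := ⟨a.1 1, by
    rw [Subalgebra.mem_centralizer_iff]
    rintro _ ⟨n, rfl⟩
    rw [← A_left, ← A_right, mul_one, one_mul]⟩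
  map_add' _ _ := rfl
  map_smul' _ _ := rfl

/-- The map `x ⊗ y ↦ x a(y)`. -/
def rightApply {ι : N →ₐ[K] M} (a : A ι) : TensorSq ι →ₗ[K] M :=
  liftSq ι ((LinearMap.mul K M).compl₁₂ LinearMap.id a.1)
    (fun m n m' => by simp [A_left, mul_assoc])

@[simp] theorem rightApply_tmul {ι : N →ₐ[K] M} (a : A ι) (x y : M) :
    rightApply a (tmul ι x y) = x * a.1 y := by
  simp [rightApply]

/-- The `R`-valued pairing `(b, a) ↦ b¹ a(b²)`. -/
def pairingR (ι : N →ₐ[K] M) : B ι →ₗ[K] A ι →ₗ[K] R ι :=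
  LinearMap.mk₂ K (fun b a => ⟨rightApply a b.1, by
      rw [Subalgebra.mem_centralizer_iff]
      rintro _ ⟨n, rfl⟩
      have h1 : rightApply a ∘ₗ bimul ι (ι n) 1 = LinearMap.mulLeft K (ι n) ∘ₗ rightApply a :=
        tensorSq_ext ι fun p q => by simp [mul_assoc]
      have h2 : rightApply a ∘ₗ bimul ι 1 (ι n) = LinearMap.mulRight K (ι n) ∘ₗ rightApply a :=
        tensorSq_ext ι fun p q => by simp [mul_assoc, A_right]
      have h1' := LinearMap.congr_fun h1 b.1
      have h2' := LinearMap.congr_fun h2 b.1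
      simp only [LinearMap.comp_apply, LinearMap.mulLeft_apply, LinearMap.mulRight_apply]
        at h1' h2'
      rw [← h1', ← h2', b.2 n]⟩)
    (fun b b' a => Subtype.ext (by simp))
    (fun k b a => Subtype.ext (by simp))
    (fun b a a' => Subtype.ext (by
      have : rightApply (a + a') = rightApply a + rightApply a' :=
        tensorSq_ext ι fun p q => by simp [mul_add]
      simp [this]))
    (fun k b a => Subtype.ext (by
      have : rightApply (k • a) = k • rightApply a :=
        tensorSq_ext ι fun p q => by simp
      simp [this]))

/-- The element `r b¹ ⊗ b² r'` of `B`, for `r, r' ∈ R`. -/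
def bimulB {ι : N →ₐ[K] M} (r r' : R ι) (b : B ι) : B ι :=
  ⟨bimul ι r.1 r'.1 b.1, fun n => by
    have h := congrArg (bimul ι r.1 r'.1) (b.2 n)
    simpa [bimul_bimul, R_comm] using h⟩

/-- The map `x ⊗ y ↦ β(x) ⊗ y` of `M ⊗_N M`. -/
def mapLeft {ι : N →ₐ[K] M} (β : A ι) : TensorSq ι →ₗ[K] TensorSq ι :=
  liftSq ι ((tmulBilin ι).compl₁₂ β.1 LinearMap.id)
    (fun m n m' => by simp [A_right, tmul_balanced])

@[simp] theorem mapLeft_tmul {ι : N →ₐ[K] M} (β : A ι) (x y : M) :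
    mapLeft β (tmul ι x y) = tmul ι (β.1 x) y := by
  exact liftSq_tmul ι _ _ x y

/-- The element `β(b¹) ⊗ b²` of `B`. -/
def mapLeftB {ι : N →ₐ[K] M} (β : A ι) (b : B ι) : B ι :=
  ⟨mapLeft β b.1, fun n => by
    have h1 : mapLeft β ∘ₗ bimul ι (ι n) 1 = bimul ι (ι n) 1 ∘ₗ mapLeft β :=
      tensorSq_ext ι fun p q => by simp [A_left]
    have h2 : mapLeft β ∘ₗ bimul ι 1 (ι n) = bimul ι 1 (ι n) ∘ₗ mapLeft β :=
      tensorSq_ext ι fun p q => by simp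
    have h1' := LinearMap.congr_fun h1 b.1
    have h2' := LinearMap.congr_fun h2 b.1
    simp only [LinearMap.comp_apply] at h1' h2'
    rw [← h1', ← h2', b.2 n]⟩

/-- `Δ(a) = ∑ a(- b_i¹) b_i² e_j ⊗ λ(f_j) β_i` in `A ⊗_K A`. -/
def comulA {ι : N →ₐ[K] M} {s t : ℕ} (b : Fin s → B ι) (β : Fin s → A ι) (e f : Fin t → R ι)
    (a : A ι) : A ι ⊗[K] A ι :=
  ∑ i, ∑ j, (rho (e j) * coact a (b i)) ⊗ₜ[K] (lambda (f j) * β i)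

/-- `Δ(b) = ∑ (b_i¹ ⊗ b_i² e_j) ⊗ (f_j β_i(b¹) ⊗ b²)` in `B ⊗_K B`. -/
def comulB {ι : N →ₐ[K] M} {s t : ℕ} (b : Fin s → B ι) (β : Fin s → A ι) (e f : Fin t → R ι)
    (c : B ι) : B ι ⊗[K] B ι :=
  ∑ i, ∑ j, (bimulB 1 (e j) (b i)) ⊗ₜ[K] (bimulB (f j) 1 (mapLeftB (β i) c))

/-- The pairing `⟨b, a⟩ = φ(b¹ a(b²))`. -/
def pairing {ι : N →ₐ[K] M} (φ : R ι →ₗ[K] K) : B ι →ₗ[K] A ι →ₗ[K] K :=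
  (pairingR ι).compr₂ φ

end Extension

end DepthTwo

open DepthTwo

/-! The weak Hopf structures come from duality. For index-one coordinates `(φ, e, f)` the form `⟨b,
a⟩ = φ(b¹ a(b²))` is perfect: `φ` is nondegenerate on `R`, so vanishing of the scalar pairing forces
vanishing of the `R`-valued one, and a right quasibasis `∑ γ_j(m) c_j¹ ⊗ c_j² = 1 ⊗ m` recovers both
`b` and `a` from `R`-valued pairings. Finite dimension holds because `R` is finite-dimensional and a
left quasibasis generates `A` and `B` over `R`. Each algebra then receives the coalgebra structure
dual to the multiplication and unit of the other. Coassociativity and counitality are automatic,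
multiplicativity of the coproduct is a self-dual condition, weak comultiplicativity of one unit is
the transpose of weak multiplicativity of the other counit, and the antipode axioms are self-dual.
What remains is to compute.

All computations rest on two contractions. Applying `a(x -) -` to the quasibasis equation gives `∑
a(x b_i¹) b_i² β_i(y) = a(x y)` (`sum_coactFun_mul`), so the terms `a(- b_i¹) b_i²` and `β_i` play
the roles of `a₍₁₎` and `a₍₂₎` over `R`. The tensor `∑ e_j ⊗ f_j` lifts this from `R` to `K`: `∑ φ(r
e_j) f_j = r` merges two scalars into one, and `∑ e_j f_j = 1` lets it be inserted and removed
freely. The antipode is the transpose taking `φ(b¹ a(b²))` to `φ(a(b¹) b²)`.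

A Frobenius homomorphism `E` is a left integral because its values lie in `N` and `a` is right
`N`-linear, so `a E = λ(a(1)) E`, while `Π^L(a) = λ(a(1))`. It is nondegenerate because its dual
bases recover `b` from `m ↦ b¹ E(b² m)`.

Index-one coordinates exist because a separable algebra is finite-dimensional and semisimple, hence
a product of matrix rings over division rings, with a nondegenerate functional and dual bases. The
map `c ↦ ∑ e_j c v_j` is central-valued and linear over the centre, and it attains `1` by
separability. Units generate each factor additively, so it attains `1` at a unit, and twisting the
coordinates by that unit makes the index one. -/

namespace DepthTwo

/-! Perfect pairings of tensor products, and dual coalgebras -/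

section PairTensor

open LinearMap

variable {K H H' G G' : Type*} [Field K] [AddCommGroup H] [Module K H] [AddCommGroup H']
  [Module K H'] [AddCommGroup G] [Module K G] [AddCommGroup G'] [Module K G']

/-- The pairing of `H' ⊗ G'` with `H ⊗ G` given by pairings of `H'` with `H` and `G'` with `G`. -/
noncomputable def pairTensor (p : H' →ₗ[K] H →ₗ[K] K) (q : G' →ₗ[K] G →ₗ[K] K) :
    H' ⊗[K] G' →ₗ[K] H ⊗[K] G →ₗ[K] K :=
  TensorProduct.dualDistrib K H G ∘ₗ TensorProduct.map p q

@[simp] theorem pairTensor_tmul (p : H' →ₗ[K] H →ₗ[K] K) (q : G' →ₗ[K] G →ₗ[K] K) (x : H')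
    (y : G') (u : H) (v : G) :
    pairTensor p q (x ⊗ₜ y) (u ⊗ₜ v) = p x u * q y v := by
  simp [pairTensor]

theorem pairTensor_tmul_left (p : H' →ₗ[K] H →ₗ[K] K) (q : G' →ₗ[K] G →ₗ[K] K) (x : H')
    (y : G') (w : H ⊗[K] G) :
    pairTensor p q (x ⊗ₜ y) w = LinearMap.mul' K K (TensorProduct.map (p x) (q y) w) := by
  have : pairTensor p q (x ⊗ₜ y) = LinearMap.mul' K K ∘ₗ TensorProduct.map (p x) (q y) :=
    TensorProduct.ext' fun u v => by simp
  rw [this]; rfl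

theorem pairTensor_flip (p : H' →ₗ[K] H →ₗ[K] K) (q : G' →ₗ[K] G →ₗ[K] K) :
    (pairTensor p q).flip = pairTensor p.flip q.flip :=
  TensorProduct.ext' fun u v => TensorProduct.ext' fun x y => by simp

theorem pairTensor_bijective [FiniteDimensional K H] [FiniteDimensional K G]
    {p : H' →ₗ[K] H →ₗ[K] K} {q : G' →ₗ[K] G →ₗ[K] K}
    (hp : Function.Bijective p) (hq : Function.Bijective q) :
    Function.Bijective (pairTensor p q) := by
  have h1 : Function.Bijective (TensorProduct.map p q) :=
    (TensorProduct.congr (LinearEquiv.ofBijective p hp) (LinearEquiv.ofBijective q hq)).bijective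
  have h2 : Function.Bijective (TensorProduct.dualDistrib K H G) :=
    (TensorProduct.dualDistribEquiv K H G).bijective
  exact h2.comp h1

instance pairTensor_isPerfPair [FiniteDimensional K H] [FiniteDimensional K G]
    [FiniteDimensional K H'] [FiniteDimensional K G']
    (p : H' →ₗ[K] H →ₗ[K] K) (q : G' →ₗ[K] G →ₗ[K] K) [p.IsPerfPair] [q.IsPerfPair] :
    (pairTensor p q).IsPerfPair where
  bijective_left := pairTensor_bijective (IsPerfPair.bijective_left p)
    (IsPerfPair.bijective_left q)
  bijective_right := by
    rw [pairTensor_flip]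
    exact pairTensor_bijective (IsPerfPair.bijective_right p) (IsPerfPair.bijective_right q)

theorem eq_of_pair_eq (p : H' →ₗ[K] H →ₗ[K] K) [p.IsPerfPair] {w w' : H}
    (h : ∀ b, p b w = p b w') : w = w' :=
  (IsPerfPair.bijective_right p).1 (LinearMap.ext h)

theorem eq_of_pairTensor_eq [FiniteDimensional K H] [FiniteDimensional K G]
    [FiniteDimensional K H'] [FiniteDimensional K G']
    (p : H' →ₗ[K] H →ₗ[K] K) (q : G' →ₗ[K] G →ₗ[K] K) [p.IsPerfPair] [q.IsPerfPair]
    {w w' : H ⊗[K] G} (h : ∀ x y, pairTensor p q (x ⊗ₜ y) w = pairTensor p q (x ⊗ₜ y) w') :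
    w = w' :=
  eq_of_pair_eq (pairTensor p q) fun b => by
    induction b with
    | zero => simp
    | tmul x y => exact h x y
    | add x y hx hy => simp [hx, hy]

theorem pairTensor_map_map (p : H' →ₗ[K] H →ₗ[K] K) {S T : H →ₗ[K] H} {S' T' : H' →ₗ[K] H'}
    (hS : ∀ b a, p (S' b) a = p b (S a)) (hT : ∀ b a, p (T' b) a = p b (T a))
    (v : H' ⊗[K] H') (w : H ⊗[K] H) :
    pairTensor p p (TensorProduct.map S' T' v) w = pairTensor p p v (TensorProduct.map S T w) := by
  induction v with
  | zero => simp
  | add x y hx hy => simp only [map_add, LinearMap.add_apply, hx, hy]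
  | tmul s t =>
    induction w with
    | zero => simp
    | add x y hx hy => simp only [map_add, hx, hy]
    | tmul x y => simp [hS, hT]

end PairTensor

/-! ### The coproduct dual to a multiplication, and weak bialgebras from a perfect pairing. -/

section DualComul

open LinearMap

variable {K H H' : Type*} [Field K] [Ring H] [Algebra K H] [Ring H'] [Algebra K H']
  [FiniteDimensional K H] [FiniteDimensional K H'] (p : H' →ₗ[K] H →ₗ[K] K) [p.IsPerfPair]

/-- The coproduct of `H` dual to the multiplication of `H'`. -/
noncomputable def dualComul : H →ₗ[K] H ⊗[K] H :=
  (LinearEquiv.ofBijective (pairTensor p p).flip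
    (IsPerfPair.bijective_right (pairTensor p p))).symm.toLinearMap ∘ₗ
      (LinearMap.lcomp K K (LinearMap.mul' K H')) ∘ₗ p.flip

theorem pairTensor_dualComul (v : H' ⊗[K] H') (a : H) :
    pairTensor p p v (dualComul p a) = p (LinearMap.mul' K H' v) a := by
  have h := LinearEquiv.apply_symm_apply (LinearEquiv.ofBijective (pairTensor p p).flip
    (IsPerfPair.bijective_right (pairTensor p p)))
      ((LinearMap.lcomp K K (LinearMap.mul' K H')) (p.flip a))
  exact LinearMap.congr_fun h v

/-- The criterion by which explicit coproduct formulas are recognised; uniqueness is perfectness of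
the pairing on tensor squares. -/
theorem eq_dualComul {w : H ⊗[K] H} {a : H}
    (h : ∀ b b', pairTensor p p (b ⊗ₜ b') w = p (b * b') a) : w = dualComul p a :=
  eq_of_pairTensor_eq p p fun b b' => by simp [h, pairTensor_dualComul]

/-- The coalgebra structure of `H` dual to the algebra structure of `H'`. -/
noncomputable abbrev dualCoalgebra : Coalgebra K H where
  comul := dualComul p
  counit := p 1
  coassoc := LinearMap.ext fun a => by
    -- Tested against `H' ⊗ (H' ⊗ H')`, coassociativity becomes associativity of `H'`.
    refine eq_of_pairTensor_eq p (pairTensor p p) fun b v => ?_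
    have h1 : ∀ w : H ⊗[K] H, pairTensor p (pairTensor p p) (b ⊗ₜ v)
        (TensorProduct.assoc K H H H ((dualComul p).rTensor H w)) =
        pairTensor p p (TensorProduct.map (LinearMap.mul' K H') LinearMap.id
          ((TensorProduct.assoc K H' H' H').symm (b ⊗ₜ v))) w := by
      intro w
      induction v with
      | zero => simp
      | add x y hx hy => simp only [TensorProduct.tmul_add, map_add, LinearMap.add_apply, hx, hy]
      | tmul b' b'' =>
        induction w with
        | zero => simp
        | add x y hx hy => simp only [map_add, hx, hy]
        | tmul x y =>
          have h2 : ∀ u : H ⊗[K] H, pairTensor p (pairTensor p p) (b ⊗ₜ (b' ⊗ₜ b''))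
              (TensorProduct.assoc K H H H (u ⊗ₜ y)) = pairTensor p p (b ⊗ₜ b') u * p b'' y := by
            intro u
            induction u with
            | zero => simp
            | add x y hx hy => simp only [TensorProduct.add_tmul, map_add, hx, hy, add_mul]
            | tmul x y => simp [mul_assoc]
          simp [h2, pairTensor_dualComul]
    have h3 : ∀ w : H ⊗[K] H, pairTensor p (pairTensor p p) (b ⊗ₜ v)
        ((dualComul p).lTensor H w) = pairTensor p p (b ⊗ₜ (LinearMap.mul' K H' v)) w := by
      intro w
      induction w with
      | zero => simp
      | add x y hx hy => simp only [map_add, hx, hy]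
      | tmul x y => simp [pairTensor_dualComul]
    simp only [LinearMap.comp_apply, LinearEquiv.coe_coe]
    rw [h1, h3, pairTensor_dualComul, pairTensor_dualComul]
    clear h1 h3
    induction v with
    | zero => simp
    | add x y hx hy => simp only [TensorProduct.tmul_add, map_add, LinearMap.add_apply, hx, hy]
    | tmul b' b'' => simp [mul_assoc]
  rTensor_counit_comp_comul := LinearMap.ext fun a => by
    apply (TensorProduct.lid K H).injective
    refine eq_of_pair_eq p fun b => ?_
    have h : ∀ w : H ⊗[K] H, p b (TensorProduct.lid K H ((p 1).rTensor H w)) =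
        pairTensor p p (1 ⊗ₜ b) w := by
      intro w
      induction w with
      | zero => simp
      | add x y hx hy => simp only [map_add, hx, hy]
      | tmul x y => simp
    simp [h, pairTensor_dualComul]
  lTensor_counit_comp_comul := LinearMap.ext fun a => by
    apply (TensorProduct.rid K H).injective
    refine eq_of_pair_eq p fun b => ?_
    have h : ∀ w : H ⊗[K] H, p b (TensorProduct.rid K H ((p 1).lTensor H w)) =
        pairTensor p p (b ⊗ₜ 1) w := by
      intro w
      induction w with
      | zero => simp
      | add x y hx hy => simp only [map_add, hx, hy]
      | tmul x y => simp [mul_comm]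
    simp [h, pairTensor_dualComul]

theorem pairTensor_flip_dualComul (b : H') (w : H ⊗[K] H) :
    pairTensor p p (dualComul p.flip b) w = p b (LinearMap.mul' K H w) := by
  have h := pairTensor_dualComul p.flip w b
  rw [← pairTensor_flip] at h
  exact h

/-- Isolates the swap of the two middle factors, which is its own transpose. -/
theorem tensor_mul_eq {K L : Type*} [Field K] [Ring L] [Algebra K L] (w w' : L ⊗[K] L) :
    w * w' = TensorProduct.map (LinearMap.mul' K L) (LinearMap.mul' K L)
        (TensorProduct.tensorTensorTensorComm K L L L L (w ⊗ₜ w')) := by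
  induction w with
  | zero => rw [TensorProduct.zero_tmul, zero_mul, map_zero, map_zero]
  | add x y hx hy => rw [TensorProduct.add_tmul, add_mul, map_add, map_add, hx, hy]
  | tmul x y =>
    induction w' with
    | zero => rw [TensorProduct.tmul_zero, mul_zero, map_zero, map_zero]
    | add x y hx hy => rw [TensorProduct.tmul_add, mul_add, map_add, map_add, hx, hy]
    | tmul x y =>
      rw [TensorProduct.tensorTensorTensorComm_tmul, TensorProduct.map_tmul, mul'_apply,
        mul'_apply, Algebra.TensorProduct.tmul_mul_tmul]

/-- Multiplicativity is self-dual: for either algebra it says that `⟨b b', a a'⟩` equals the pairing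
of `Δ(b) ⊗ Δ(b')` with `Δ(a) ⊗ Δ(a')` after the middle factors are swapped. It therefore has to be
checked on one side only. -/
theorem dualComul_mul_of_flip
    (hmul : ∀ b b' : H', dualComul p.flip (b * b') = dualComul p.flip b * dualComul p.flip b')
    (a a' : H) : dualComul p (a * a') = dualComul p a * dualComul p a' := by
  have key : ∀ (b b' : H') (W : (H ⊗[K] H) ⊗[K] (H ⊗[K] H)),
      pairTensor p p (b ⊗ₜ b') (TensorProduct.map (LinearMap.mul' K H) (LinearMap.mul' K H) W) =
      pairTensor (pairTensor p p) (pairTensor p p) (dualComul p.flip b ⊗ₜ dualComul p.flip b')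
        W := by
    intro b b' W
    induction W with
    | zero => simp
    | add x y hx hy => simp only [map_add, hx, hy]
    | tmul x y => simp [pairTensor_flip_dualComul]
  have key' : ∀ (a a' : H) (V : (H' ⊗[K] H') ⊗[K] (H' ⊗[K] H')),
      pairTensor p p (TensorProduct.map (LinearMap.mul' K H') (LinearMap.mul' K H') V)
        (a ⊗ₜ a') =
      pairTensor (pairTensor p p) (pairTensor p p) V (dualComul p a ⊗ₜ dualComul p a') := by
    intro a a' V
    induction V with
    | zero => simp
    | add x y hx hy => simp only [map_add, LinearMap.add_apply, hx, hy]
    | tmul x y => simp [pairTensor_dualComul]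
  have comm : ∀ (V : (H' ⊗[K] H') ⊗[K] (H' ⊗[K] H')) (W : (H ⊗[K] H) ⊗[K] (H ⊗[K] H)),
      pairTensor (pairTensor p p) (pairTensor p p)
        (TensorProduct.tensorTensorTensorComm K H' H' H' H' V) W =
      pairTensor (pairTensor p p) (pairTensor p p) V
        (TensorProduct.tensorTensorTensorComm K H H H H W) := by
    intro V W
    induction V with
    | zero => simp
    | add x y hx hy => simp only [map_add, LinearMap.add_apply, hx, hy]
    | tmul v v' =>
    induction W with
    | zero => simp
    | add x y hx hy => simp only [map_add, hx, hy]
    | tmul w w' =>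
    induction v with
    | zero => simp
    | add x y hx hy =>
      simp only [TensorProduct.add_tmul, map_add, LinearMap.add_apply, hx, hy]
    | tmul v1 v2 =>
    induction v' with
    | zero => simp
    | add x y hx hy =>
      simp only [TensorProduct.tmul_add, map_add, LinearMap.add_apply, hx, hy]
    | tmul v3 v4 =>
    induction w with
    | zero => simp
    | add x y hx hy =>
      simp only [TensorProduct.add_tmul, map_add, hx, hy]
    | tmul w1 w2 =>
    induction w' with
    | zero => simp
    | add x y hx hy =>
      simp only [TensorProduct.tmul_add, map_add, hx, hy]
    | tmul w3 w4 =>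
      simp only [TensorProduct.tensorTensorTensorComm_tmul, pairTensor_tmul]
      ring
  refine (eq_dualComul p fun b b' => ?_).symm
  rw [tensor_mul_eq, key, ← comm, ← key', ← tensor_mul_eq, ← hmul, pairTensor_flip_dualComul]
  simp

/-- Transpose of the counit axiom of `H'`: the pairing of `a ⊗ b ⊗ c` with `Δ²(1)` is `⟨a b c, 1⟩`,
the counit of the product. -/
theorem dualComul_one_left
    (h : ∀ a b c : H', p (a * b * c) 1 =
      LinearMap.mul' K K (TensorProduct.map (p.flip 1 ∘ₗ LinearMap.mulLeft K a)
        (p.flip 1 ∘ₗ LinearMap.mulRight K c) (dualComul p.flip b))) :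
    TensorProduct.assoc K H H H (dualComul p 1 ⊗ₜ[K] 1) * ((1 : H) ⊗ₜ[K] dualComul p 1) =
      (dualComul p).lTensor H (dualComul p 1) := by
  refine eq_of_pairTensor_eq p (pairTensor p p) fun b v => ?_
  induction v with
  | zero => simp
  | add x y hx hy => simp only [TensorProduct.tmul_add, map_add, LinearMap.add_apply, hx, hy]
  | tmul b' b'' =>
  have h1 : ∀ w : H ⊗[K] H, pairTensor p (pairTensor p p) (b ⊗ₜ (b' ⊗ₜ b''))
      ((dualComul p).lTensor H w) = pairTensor p p (b ⊗ₜ (b' * b'')) w := by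
    intro w
    induction w with
    | zero => simp
    | add x y hx hy => simp only [map_add, hx, hy]
    | tmul x y => simp [pairTensor_dualComul]
  have h2 : ∀ w w' : H ⊗[K] H, pairTensor p (pairTensor p p) (b ⊗ₜ (b' ⊗ₜ b''))
      (TensorProduct.assoc K H H H (w ⊗ₜ[K] 1) * ((1 : H) ⊗ₜ[K] w')) =
      LinearMap.mul' K K (TensorProduct.map
        ((pairTensor p p).flip w ∘ₗ TensorProduct.mk K H' H' b)
        ((pairTensor p p).flip w' ∘ₗ (TensorProduct.mk K H' H').flip b'')
        (dualComul p.flip b')) := by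
    intro w w'
    induction w with
    | zero => simp
    | add x y hx hy =>
      simp only [TensorProduct.add_tmul, add_mul, map_add, hx, hy, LinearMap.add_comp,
        TensorProduct.map_add_left, LinearMap.add_apply]
    | tmul x y =>
      induction w' with
      | zero => simp
      | add x y hx hy =>
        simp only [TensorProduct.tmul_add, mul_add, map_add, hx, hy, LinearMap.add_comp,
          TensorProduct.map_add_right, LinearMap.add_apply]
      | tmul x' y' =>
        -- Only the middle leg carries a genuine product; pairing it with `b'` splits `b'` by its
        -- coproduct.
        have h3 := pairTensor_flip_dualComul p b' (y ⊗ₜ x')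
        simp only [mul'_apply] at h3
        simp only [TensorProduct.assoc_tmul, Algebra.TensorProduct.tmul_mul_tmul, mul_one, one_mul,
          pairTensor_tmul, ← h3]
        generalize dualComul p.flip b' = V
        induction V with
        | zero => simp
        | add x y hx hy => simp only [map_add, LinearMap.add_apply, mul_add, add_mul, hx, hy]
        | tmul s t => simp; ring
  rw [h1, h2, pairTensor_dualComul, mul'_apply, ← mul_assoc, h]
  congr 2
  · congr 1 <;> ext s <;> simp [pairTensor_dualComul]

/-- Here the middle leg is multiplied in the opposite order, which exchanges the two legs of the
coproduct in the counit axiom. -/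
theorem dualComul_one_right
    (h : ∀ a b c : H', p (a * b * c) 1 =
      LinearMap.mul' K K (TensorProduct.map (p.flip 1 ∘ₗ LinearMap.mulRight K c)
        (p.flip 1 ∘ₗ LinearMap.mulLeft K a) (dualComul p.flip b))) :
    ((1 : H) ⊗ₜ[K] dualComul p 1) * TensorProduct.assoc K H H H (dualComul p 1 ⊗ₜ[K] 1) =
      (dualComul p).lTensor H (dualComul p 1) := by
  refine eq_of_pairTensor_eq p (pairTensor p p) fun b v => ?_
  induction v with
  | zero => simp
  | add x y hx hy => simp only [TensorProduct.tmul_add, map_add, LinearMap.add_apply, hx, hy]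
  | tmul b' b'' =>
  have h1 : ∀ w : H ⊗[K] H, pairTensor p (pairTensor p p) (b ⊗ₜ (b' ⊗ₜ b''))
      ((dualComul p).lTensor H w) = pairTensor p p (b ⊗ₜ (b' * b'')) w := by
    intro w
    induction w with
    | zero => simp
    | add x y hx hy => simp only [map_add, hx, hy]
    | tmul x y => simp [pairTensor_dualComul]
  have h2 : ∀ w w' : H ⊗[K] H, pairTensor p (pairTensor p p) (b ⊗ₜ (b' ⊗ₜ b''))
      (((1 : H) ⊗ₜ[K] w') * TensorProduct.assoc K H H H (w ⊗ₜ[K] 1)) =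
      LinearMap.mul' K K (TensorProduct.map
        ((pairTensor p p).flip w' ∘ₗ (TensorProduct.mk K H' H').flip b'')
        ((pairTensor p p).flip w ∘ₗ TensorProduct.mk K H' H' b)
        (dualComul p.flip b')) := by
    intro w w'
    induction w with
    | zero => simp
    | add x y hx hy =>
      simp only [TensorProduct.add_tmul, mul_add, map_add, hx, hy, LinearMap.add_comp,
        TensorProduct.map_add_right, LinearMap.add_apply]
    | tmul x y =>
      induction w' with
      | zero => simp
      | add x y hx hy =>
        simp only [TensorProduct.tmul_add, add_mul, map_add, hx, hy, LinearMap.add_comp,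
          TensorProduct.map_add_left, LinearMap.add_apply]
      | tmul x' y' =>
        have h3 := pairTensor_flip_dualComul p b' (x' ⊗ₜ y)
        simp only [mul'_apply] at h3
        simp only [TensorProduct.assoc_tmul, Algebra.TensorProduct.tmul_mul_tmul, mul_one, one_mul,
          pairTensor_tmul, ← h3]
        generalize dualComul p.flip b' = V
        induction V with
        | zero => simp
        | add x y hx hy => simp only [map_add, LinearMap.add_apply, mul_add, add_mul, hx, hy]
        | tmul s t => simp; ring
  rw [h1, h2, pairTensor_dualComul, mul'_apply, ← mul_assoc, h]
  congr 2
  · congr 1 <;> ext s <;> simp [pairTensor_dualComul]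

/-- Both halves of weak multiplicativity of the counit `p 1`, for the coproduct dual to `p`. -/
structure IsWeaklyMultiplicativeCounit : Prop where
  left : ∀ a b c : H, p 1 (a * b * c) =
      LinearMap.mul' K K (TensorProduct.map (p 1 ∘ₗ LinearMap.mulLeft K a)
        (p 1 ∘ₗ LinearMap.mulRight K c) (dualComul p b))
  right : ∀ a b c : H, p 1 (a * b * c) =
      LinearMap.mul' K K (TensorProduct.map (p 1 ∘ₗ LinearMap.mulRight K c)
        (p 1 ∘ₗ LinearMap.mulLeft K a) (dualComul p b))

/-- The weak bialgebra structure of `H` dual to the algebra structure of `H'`. -/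
noncomputable abbrev dualWeakBialgebra
    (hmul : ∀ a a' : H, dualComul p (a * a') = dualComul p a * dualComul p a')
    (hH : IsWeaklyMultiplicativeCounit p) (hH' : IsWeaklyMultiplicativeCounit p.flip) :
    WeakBialgebra K H :=
  { dualCoalgebra p with
    comul_mul := hmul
    comul_one_left := dualComul_one_left p hH'.left
    comul_one_right := dualComul_one_right p hH'.right
    counit_mul_left := hH.left
    counit_mul_right := hH.right }

end DualComul

/-! ### Duality of the projections, the antipode axioms and nondegeneracy. -/

section DualAntipode

open LinearMap

variable {K H H' : Type*} [Field K] [Ring H] [Algebra K H] [Ring H'] [Algebra K H']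
  [FiniteDimensional K H] [FiniteDimensional K H'] (p : H' →ₗ[K] H →ₗ[K] K) [p.IsPerfPair]

/-- The projection `Π^L` of the weak bialgebra structure dual to `p`. -/
noncomputable def dualTargetProj (x : H) : H :=
  TensorProduct.lid K H (TensorProduct.map (p 1 ∘ₗ LinearMap.mulRight K x) LinearMap.id
    (dualComul p 1))

/-- The projection `Π^R` of the weak bialgebra structure dual to `p`. -/
noncomputable def dualSourceProj (x : H) : H :=
  TensorProduct.rid K H (TensorProduct.map LinearMap.id (p 1 ∘ₗ LinearMap.mulLeft K x)
    (dualComul p 1))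

/-- The antipode axioms for the weak bialgebra structure dual to `p`. -/
structure IsDualAntipode (S : H →ₗ[K] H) : Prop where
  mul_antipode : ∀ x, LinearMap.mul' K H (S.lTensor H (dualComul p x)) = dualTargetProj p x
  antipode_mul : ∀ x, LinearMap.mul' K H (S.rTensor H (dualComul p x)) = dualSourceProj p x
  antipode_mul_antipode : ∀ x, LinearMap.mul' K H (TensorProduct.map S
    (LinearMap.mul' K H ∘ₗ S.lTensor H ∘ₗ dualComul p) (dualComul p x)) = S x

/-- The weak Hopf algebra structure of `H` dual to the algebra structure of `H'`. -/
noncomputable abbrev dualWeakHopfAlgebra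
    (hmul : ∀ a a' : H, dualComul p (a * a') = dualComul p a * dualComul p a')
    (hH : IsWeaklyMultiplicativeCounit p) (hH' : IsWeaklyMultiplicativeCounit p.flip)
    (S : H →ₗ[K] H) (hS : IsDualAntipode p S) : WeakHopfAlgebra K H :=
  { dualWeakBialgebra p hmul hH hH' with
    antipode := S
    mul_antipode := hS.mul_antipode
    antipode_mul := hS.antipode_mul
    antipode_mul_antipode := hS.antipode_mul_antipode }

/-- With `1'` the unit of `H'`, both sides equal `⟨1'₍₁₎, 1₍₁₎⟩ ⟨1'₍₂₎, a⟩ ⟨b, 1₍₂₎⟩`, which is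
symmetric in the two algebras. -/
theorem pair_dualTargetProj (b : H') (a : H) :
    p b (dualTargetProj p a) = p (dualTargetProj p.flip b) a := by
  have h1 : ∀ w : H ⊗[K] H, p b (TensorProduct.lid K H
      (TensorProduct.map (p 1 ∘ₗ LinearMap.mulRight K a) LinearMap.id w)) =
      LinearMap.mul' K K (TensorProduct.map (pairTensor p p (dualComul p.flip 1) ∘ₗ
        (TensorProduct.mk K H H).flip a) (p b) w) := by
    intro w
    induction w with
    | zero => simp
    | add x y hx hy => simp only [map_add, hx, hy]
    | tmul x y => simp [pairTensor_flip_dualComul]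
  have h2 : ∀ v : H' ⊗[K] H', p (TensorProduct.lid K H'
      (TensorProduct.map (p.flip 1 ∘ₗ LinearMap.mulRight K b) LinearMap.id v)) a =
      LinearMap.mul' K K (TensorProduct.map ((pairTensor p p).flip (dualComul p 1) ∘ₗ
        (TensorProduct.mk K H' H').flip b) (p.flip a) v) := by
    intro v
    induction v with
    | zero => simp
    | add x y hx hy => simp only [map_add, LinearMap.add_apply, hx, hy]
    | tmul x y => simp [pairTensor_dualComul]
  rw [dualTargetProj, dualTargetProj, h1, h2]
  generalize dualComul p 1 = w
  generalize dualComul p.flip 1 = v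
  induction w with
  | zero => simp
  | add x y hx hy => simp only [map_add, LinearMap.add_comp, TensorProduct.map_add_left,
      LinearMap.add_apply, hx, hy]
  | tmul x y =>
    induction v with
    | zero => simp
    | add x y hx hy => simp only [map_add, LinearMap.add_comp, TensorProduct.map_add_left,
        LinearMap.add_apply, hx, hy]
    | tmul s t => simp; ring

/-- The common value is `⟨b, 1₍₁₎⟩ ⟨1'₍₁₎, a⟩ ⟨1'₍₂₎, 1₍₂₎⟩`. -/
theorem pair_dualSourceProj (b : H') (a : H) :
    p b (dualSourceProj p a) = p (dualSourceProj p.flip b) a := by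
  have h1 : ∀ w : H ⊗[K] H, p b (TensorProduct.rid K H
      (TensorProduct.map LinearMap.id (p 1 ∘ₗ LinearMap.mulLeft K a) w)) =
      LinearMap.mul' K K (TensorProduct.map (p b) (pairTensor p p (dualComul p.flip 1) ∘ₗ
        TensorProduct.mk K H H a) w) := by
    intro w
    induction w with
    | zero => simp
    | add x y hx hy => simp only [map_add, hx, hy]
    | tmul x y => simp [pairTensor_flip_dualComul, mul_comm]
  have h2 : ∀ v : H' ⊗[K] H', p (TensorProduct.rid K H'
      (TensorProduct.map LinearMap.id (p.flip 1 ∘ₗ LinearMap.mulLeft K b) v)) a =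
      LinearMap.mul' K K (TensorProduct.map (p.flip a) ((pairTensor p p).flip (dualComul p 1) ∘ₗ
        TensorProduct.mk K H' H' b) v) := by
    intro v
    induction v with
    | zero => simp
    | add x y hx hy => simp only [map_add, LinearMap.add_apply, hx, hy]
    | tmul x y => simp [pairTensor_dualComul, mul_comm]
  rw [dualSourceProj, dualSourceProj, h1, h2]
  generalize dualComul p 1 = w
  generalize dualComul p.flip 1 = v
  induction w with
  | zero => simp
  | add x y hx hy => simp only [map_add, LinearMap.add_comp, TensorProduct.map_add_right,
      LinearMap.add_apply, hx, hy]
  | tmul x y =>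
    induction v with
    | zero => simp
    | add x y hx hy => simp only [map_add, LinearMap.add_comp, TensorProduct.map_add_right,
        LinearMap.add_apply, hx, hy]
    | tmul s t => simp; ring

theorem pair_mul_map_dualComul {S T : H →ₗ[K] H} {S' T' : H' →ₗ[K] H'}
    (hS : ∀ b a, p (S' b) a = p b (S a)) (hT : ∀ b a, p (T' b) a = p b (T a)) (b : H') (a : H) :
    p (LinearMap.mul' K H' (TensorProduct.map S' T' (dualComul p.flip b))) a =
      p b (LinearMap.mul' K H (TensorProduct.map S T (dualComul p a))) := by
  rw [← pairTensor_dualComul, pairTensor_map_map p hS hT, pairTensor_flip_dualComul]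

/-- Each axiom equates a convolution product of copies of `id` and `S` with `Π^L`, `Π^R` or `S`.
Convolution products transpose to convolution products, and both projections transpose to their
counterparts. -/
theorem IsDualAntipode.flip {S : H →ₗ[K] H} {S' : H' →ₗ[K] H'} (h : IsDualAntipode p S)
    (hS : ∀ b a, p (S' b) a = p b (S a)) : IsDualAntipode p.flip S' where
  mul_antipode b := eq_of_pair_eq p.flip fun a => by
    rw [flip_apply, flip_apply, ← pair_dualTargetProj, ← h.mul_antipode]
    exact pair_mul_map_dualComul p (fun _ _ => rfl) hS b a
  antipode_mul b := eq_of_pair_eq p.flip fun a => by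
    rw [flip_apply, flip_apply, ← pair_dualSourceProj, ← h.antipode_mul]
    exact pair_mul_map_dualComul p hS (fun _ _ => rfl) b a
  antipode_mul_antipode b := eq_of_pair_eq p.flip fun a => by
    rw [flip_apply, flip_apply, hS, ← h.antipode_mul_antipode]
    exact pair_mul_map_dualComul p hS
      (fun b a => pair_mul_map_dualComul p (fun _ _ => rfl) hS b a) b a

/-- If `(b, c) ↦ ⟨b c, l⟩` is nondegenerate on one side, then `l` is nondegenerate. -/
theorem bijective_dualComul_of_pair_mul (l : H) (h : ∀ b, (∀ c, p (b * c) l = 0) → b = 0) :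
    Function.Bijective (fun g : H →ₗ[K] K =>
      TensorProduct.lid K H (g.rTensor H (dualComul p l))) ∧
    Function.Bijective (fun g : H →ₗ[K] K =>
      TensorProduct.rid K H (g.lTensor H (dualComul p l))) := by
  let F : H' →ₗ[K] H' →ₗ[K] K := (LinearMap.mul K H').compr₂ (p.flip l)
  have hF : Function.Injective F := by
    rw [← LinearMap.ker_eq_bot, LinearMap.ker_eq_bot']
    exact fun b hb => h b fun c => LinearMap.congr_fun hb c
  -- In finite dimension, nondegeneracy of `F(b, c) = ⟨b c, l⟩` on one side gives it on the other.
  have hF' : Function.Injective F.flip := by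
    rw [LinearMap.flip_injective_iff₁]
    exact (LinearMap.injective_iff_surjective_of_finrank_eq_finrank
      (Subspace.dual_finrank_eq (K := K) (V := H')).symm).1 hF
  have dim : Module.finrank K (Module.Dual K H) = Module.finrank K H := Subspace.dual_finrank_eq
  -- For `g = ⟨b, -⟩` the two maps send `g` to the elements representing `F(b, -)` and `F(-, b)`.
  have eval1 : ∀ (b c : H') (w : H ⊗[K] H),
      p c (TensorProduct.lid K H ((p b).rTensor H w)) = pairTensor p p (b ⊗ₜ c) w := by
    intro b c w
    induction w with
    | zero => simp
    | add x y hx hy => simp only [map_add, hx, hy]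
    | tmul x y => simp
  have eval2 : ∀ (b c : H') (w : H ⊗[K] H),
      p c (TensorProduct.rid K H ((p b).lTensor H w)) = pairTensor p p (c ⊗ₜ b) w := by
    intro b c w
    induction w with
    | zero => simp
    | add x y hx hy => simp only [map_add, hx, hy]
    | tmul x y => simp [mul_comm]
  constructor
  · let f : Module.Dual K H →ₗ[K] H :=
      (TensorProduct.lid K H).toLinearMap ∘ₗ (LinearMap.applyₗ (dualComul p l)) ∘ₗ
        LinearMap.rTensorHom H
    have hf : Function.Injective f := by
      rw [← LinearMap.ker_eq_bot, LinearMap.ker_eq_bot']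
      intro g hg
      obtain ⟨b, rfl⟩ := (IsPerfPair.bijective_left p).2 g
      have : b = 0 := hF (by
        rw [map_zero]
        ext c
        have h1 := eval1 b c (dualComul p l)
        rw [pairTensor_dualComul, mul'_apply] at h1
        exact h1.symm.trans ((congrArg (p c) hg).trans (map_zero _)))
      rw [this, map_zero]
    exact ⟨hf, (LinearMap.injective_iff_surjective_of_finrank_eq_finrank dim).1 hf⟩
  · let f : Module.Dual K H →ₗ[K] H :=
      (TensorProduct.rid K H).toLinearMap ∘ₗ (LinearMap.applyₗ (dualComul p l)) ∘ₗ
        LinearMap.lTensorHom H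
    have hf : Function.Injective f := by
      rw [← LinearMap.ker_eq_bot, LinearMap.ker_eq_bot']
      intro g hg
      obtain ⟨b, rfl⟩ := (IsPerfPair.bijective_left p).2 g
      have : b = 0 := hF' (by
        rw [map_zero]
        ext c
        have h1 := eval2 b c (dualComul p l)
        rw [pairTensor_dualComul, mul'_apply] at h1
        exact h1.symm.trans ((congrArg (p c) hg).trans (map_zero _)))
      rw [this, map_zero]
    exact ⟨hf, (LinearMap.injective_iff_surjective_of_finrank_eq_finrank dim).1 hf⟩

end DualAntipode

/-! ### Calculus in `M ⊗_N M`, and the actions of `R` on `A` and `B`. -/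

section Extension

variable {K N M : Type*} [Field K] [Ring N] [Algebra K N] [Ring M] [Algebra K M] {ι : N →ₐ[K] M}

theorem tensorSq_induction {P : TensorSq ι → Prop} (zero : P 0) (tmul : ∀ x y, P (tmul ι x y))
    (add : ∀ z z', P z → P z' → P (z + z')) (z : TensorSq ι) : P z := by
  obtain ⟨w, rfl⟩ := (balancedRel ι).mkQ_surjective z
  induction w with
  | zero => simpa using zero
  | tmul x y => exact tmul x y
  | add x y hx hy => rw [map_add]; exact add _ _ hx hy

theorem A_ext {a a' : A ι} (h : ∀ m, a.1 m = a'.1 m) : a = a' :=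
  Subtype.ext (LinearMap.ext h)

@[simp] theorem A_mul_apply (a a' : A ι) (m : M) : (a * a').1 m = a.1 (a'.1 m) := rfl

@[simp] theorem A_one_apply (m : M) : (1 : A ι).1 m = m := rfl

@[simp] theorem A_sum_apply {τ : Type*} (s : Finset τ) (a : τ → A ι) (m : M) :
    (∑ i ∈ s, a i).1 m = ∑ i ∈ s, (a i).1 m := by
  classical
  induction s using Finset.induction_on with
  | empty => rfl
  | insert i s hi h => rw [Finset.sum_insert hi, Finset.sum_insert hi, ← h]; rfl

@[simp] theorem lambda_apply (r : R ι) (m : M) : (lambda r).1 m = r.1 * m := rfl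

@[simp] theorem rho_apply (r : R ι) (m : M) : (rho r).1 m = m * r.1 := rfl

@[simp] theorem coact_apply (a : A ι) (b : B ι) (m : M) : (coact a b).1 m = coactFun a m b.1 := rfl

@[simp] theorem evalOne_val (a : A ι) : (evalOne ι a).1 = a.1 1 := rfl

@[simp] theorem pairingR_val (b : B ι) (a : A ι) : (pairingR ι b a).1 = rightApply a b.1 := rfl

theorem pairing_apply (φ : R ι →ₗ[K] K) (b : B ι) (a : A ι) :
    pairing φ b a = φ (pairingR ι b a) := rfl

/-- The map `r ↦ λ(r)` as a linear map. -/
noncomputable def lambdaHom (ι : N →ₐ[K] M) : R ι →ₗ[K] A ι where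
  toFun := lambda
  map_add' r s := A_ext fun m => by simp [add_mul]
  map_smul' k r := A_ext fun m => by simp

@[simp] theorem lambdaHom_apply (r : R ι) : lambdaHom ι r = lambda r := rfl

/-- The map `r ↦ ρ(r)` as a linear map. -/
noncomputable def rhoHom (ι : N →ₐ[K] M) : R ι →ₗ[K] A ι where
  toFun := rho
  map_add' r s := A_ext fun m => by simp [mul_add]
  map_smul' k r := A_ext fun m => by simp

theorem bimul_add_left (x x' y : M) (z : TensorSq ι) :
    bimul ι (x + x') y z = bimul ι x y z + bimul ι x' y z := by
  induction z using tensorSq_induction with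
  | zero => simp
  | tmul u v => simp [add_mul, tmul_add_left]
  | add z z' h h' => simp only [map_add, h, h']; abel

theorem bimul_add_right (x y y' : M) (z : TensorSq ι) :
    bimul ι x (y + y') z = bimul ι x y z + bimul ι x y' z := by
  induction z using tensorSq_induction with
  | zero => simp
  | tmul u v => simp [mul_add, tmul_add_right]
  | add z z' h h' => simp only [map_add, h, h']; abel

theorem bimul_smul_left (k : K) (x y : M) (z : TensorSq ι) :
    bimul ι (k • x) y z = k • bimul ι x y z := by
  induction z using tensorSq_induction with
  | zero => simp
  | tmul u v => simp [tmul_smul_left]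
  | add z z' h h' => simp only [map_add, h, h', smul_add]

theorem bimul_smul_right (k : K) (x y : M) (z : TensorSq ι) :
    bimul ι x (k • y) z = k • bimul ι x y z := by
  induction z using tensorSq_induction with
  | zero => simp
  | tmul u v => simp [tmul_smul_right]
  | add z z' h h' => simp only [map_add, h, h', smul_add]

/-- The bimodule structure of `M ⊗_N M` as a bilinear map. -/
noncomputable def bimulHom (z : TensorSq ι) : M →ₗ[K] M →ₗ[K] TensorSq ι :=
  LinearMap.mk₂ K (fun x y => bimul ι x y z) (fun x x' y => bimul_add_left x x' y z)
    (fun k x y => bimul_smul_left k x y z) (fun x y y' => bimul_add_right x y y' z)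
    (fun k x y => bimul_smul_right k x y z)

theorem bimul_sum_right {τ : Type*} (s : Finset τ) (x : M) (y : τ → M) (z : TensorSq ι) :
    bimul ι x (∑ i ∈ s, y i) z = ∑ i ∈ s, bimul ι x (y i) z :=
  map_sum (bimulHom z x) y s

theorem bimul_zero_right (x : M) (z : TensorSq ι) : bimul ι x 0 z = 0 :=
  map_zero (bimulHom z x)

theorem bimul_zero_left (y : M) (z : TensorSq ι) : bimul ι 0 y z = 0 :=
  LinearMap.map_zero₂ (bimulHom z) y

@[simp] theorem bimulB_val (r r' : R ι) (b : B ι) : (bimulB r r' b).1 = bimul ι r.1 r'.1 b.1 := rfl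

@[simp] theorem mapLeftB_val (β : A ι) (b : B ι) : (mapLeftB β b).1 = mapLeft β b.1 := rfl

/-- The map `r ↦ r b¹ ⊗ b²` as a linear map. -/
noncomputable def bimulBLeft (b : B ι) : R ι →ₗ[K] B ι where
  toFun r := bimulB r 1 b
  map_add' r s := Subtype.ext (bimul_add_left r.1 s.1 1 b.1)
  map_smul' k r := Subtype.ext (bimul_smul_left k r.1 1 b.1)

/-- The map `r ↦ b¹ ⊗ b² r` as a linear map. -/
noncomputable def bimulBRight (b : B ι) : R ι →ₗ[K] B ι where
  toFun r := bimulB 1 r b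
  map_add' r s := Subtype.ext (bimul_add_right 1 r.1 s.1 b.1)
  map_smul' k r := Subtype.ext (bimul_smul_right k 1 r.1 b.1)

@[simp] theorem bimulBRight_apply (b : B ι) (r : R ι) : bimulBRight b r = bimulB 1 r b := rfl

theorem coactFun_add (a a' : A ι) (m : M) (z : TensorSq ι) :
    coactFun (a + a') m z = coactFun a m z + coactFun a' m z := by
  induction z using tensorSq_induction with
  | zero => simp
  | tmul u v => simp [add_mul]
  | add z z' h h' => simp only [map_add, h, h']; abel

theorem coactFun_smul (k : K) (a : A ι) (m : M) (z : TensorSq ι) :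
    coactFun (k • a) m z = k • coactFun a m z := by
  induction z using tensorSq_induction with
  | zero => simp
  | tmul u v => simp
  | add z z' h h' => simp only [map_add, h, h', smul_add]

/-- The `R`-valued pairing `(b, a) ↦ a(b¹) b²`. -/
noncomputable def copairingR (ι : N →ₐ[K] M) : B ι →ₗ[K] A ι →ₗ[K] R ι :=
  LinearMap.mk₂ K (fun b a => evalOne ι (coact a b))
    (fun b b' a => Subtype.ext (map_add (coactFun a 1) b.1 b'.1))
    (fun k b a => Subtype.ext (map_smul (coactFun a 1) k b.1))
    (fun b a a' => Subtype.ext (coactFun_add a a' 1 b.1))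
    (fun k b a => Subtype.ext (coactFun_smul k a 1 b.1))

@[simp] theorem copairingR_val (b : B ι) (a : A ι) : (copairingR ι b a).1 = coactFun a 1 b.1 := rfl

/-! Compatibility of the pairings with the `R`-actions -/

theorem rightApply_bimul (a : A ι) (x y : M) (z : TensorSq ι) :
    rightApply a (bimul ι x y z) = x * rightApply a (bimul ι 1 y z) := by
  induction z using tensorSq_induction with
  | zero => simp
  | tmul u v => simp [mul_assoc]
  | add z z' h h' => simp only [map_add, h, h', mul_add]

theorem rightApply_mul_rho (a : A ι) (r : R ι) (z : TensorSq ι) :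
    rightApply (a * rho r) z = rightApply a (bimul ι 1 r.1 z) := by
  induction z using tensorSq_induction with
  | zero => simp
  | tmul u v => simp
  | add z z' h h' => simp only [map_add, h, h']

theorem rightApply_rho_mul (a : A ι) (r : R ι) (z : TensorSq ι) :
    rightApply (rho r * a) z = rightApply a z * r.1 := by
  induction z using tensorSq_induction with
  | zero => simp
  | tmul u v => simp [mul_assoc]
  | add z z' h h' => simp only [map_add, h, h', add_mul]

theorem coactFun_lambda_mul (a : A ι) (r : R ι) (m : M) (z : TensorSq ι) :
    coactFun (lambda r * a) m z = r.1 * coactFun a m z := by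
  induction z using tensorSq_induction with
  | zero => simp
  | tmul u v => simp [mul_assoc]
  | add z z' h h' => simp only [map_add, h, h', mul_add]

theorem pairingR_rho_mul (b : B ι) (a : A ι) (r : R ι) :
    pairingR ι b (rho r * a) = pairingR ι b a * r :=
  Subtype.ext (rightApply_rho_mul a r b.1)

theorem pairingR_bimulB_right (b : B ι) (a : A ι) (r : R ι) :
    pairingR ι (bimulB 1 r b) a = pairingR ι b (a * rho r) :=
  Subtype.ext (rightApply_mul_rho a r b.1).symm

theorem pairingR_bimulB_left (b : B ι) (a : A ι) (r : R ι) :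
    pairingR ι (bimulB r 1 b) a = r * pairingR ι b a :=
  Subtype.ext (by
    have h := rightApply_bimul a r.1 1 b.1
    rw [bimul_one_one] at h
    exact h)

theorem copairingR_lambda_mul (b : B ι) (a : A ι) (r : R ι) :
    copairingR ι b (lambda r * a) = r * copairingR ι b a :=
  Subtype.ext (coactFun_lambda_mul a r 1 b.1)

theorem copairingR_bimulB_right (b : B ι) (a : A ι) (r : R ι) :
    copairingR ι (bimulB 1 r b) a = copairingR ι b a * r :=
  Subtype.ext (by
    have h := coactFun_bimul a 1 1 r.1 b.1
    rw [one_mul] at h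
    exact h)

theorem evalOne_lambda_mul (a : A ι) (r : R ι) : evalOne ι (lambda r * a) = r * evalOne ι a := rfl

theorem evalOne_rho_mul (a : A ι) (r : R ι) : evalOne ι (rho r * a) = evalOne ι a * r := rfl

theorem pairingR_one_left (a : A ι) : pairingR ι 1 a = evalOne ι a :=
  Subtype.ext (by simp [B_one_val])

theorem pairingR_mul_bimulB_right (b b' : B ι) (r : R ι) :
    pairingR ι (b * bimulB 1 r b') 1 = pairingR ι (b * b') 1 * r :=
  Subtype.ext (by
    change rightApply 1 (actB b (bimul ι 1 r.1 b'.1)) = rightApply 1 (actB b b'.1) * r.1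
    rw [actB_bimul]
    generalize actB b b'.1 = z
    induction z using tensorSq_induction with
    | zero => simp
    | tmul u v => simp [mul_assoc]
    | add z z' h h' => simp only [map_add, h, h', add_mul])

theorem pairingR_mul_bimulB_left (b b' : B ι) (r : R ι) :
    pairingR ι (b * bimulB r 1 b') 1 = r * pairingR ι (b * b') 1 :=
  Subtype.ext (by
    change rightApply 1 (actB b (bimul ι r.1 1 b'.1)) = r.1 * rightApply 1 (actB b b'.1)
    rw [actB_bimul, rightApply_bimul, bimul_one_one]; rfl)

/-! Quasibases -/

/-- A right depth two quasibasis: `∑ γ_j(m) c_j¹ ⊗ c_j² = 1 ⊗ m`. -/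
def IsRightQuasibasis {s : ℕ} (c : Fin s → B ι) (γ : Fin s → A ι) : Prop :=
  ∀ m : M, ∑ i, bimul ι ((γ i).1 m) 1 (c i).1 = tmul ι 1 m

/-- The unit vectors of `M^s` commute with `N`, so their images under `p` lie in `B`; the
coordinates of `m ↦ q(m ⊗ 1)` lie in `A`. The quasibasis equation is `p ∘ q = id` at `m ⊗ 1`,
expanded by right `M`-linearity of `p`. -/
theorem IsLeftDepthTwo.exists_quasibasis (h : IsLeftDepthTwo ι) :
    ∃ (s : ℕ) (b : Fin s → B ι) (β : Fin s → A ι), IsLeftQuasibasis b β := by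
  obtain ⟨s, -, p, q, hp, hq, hpq⟩ := h
  refine ⟨s, fun i => ⟨p (Pi.single i 1), fun n => ?_⟩, fun i =>
    ⟨LinearMap.proj i ∘ₗ q ∘ₗ (tmulBilin ι).flip 1, fun n n' m => ?_⟩, fun m => ?_⟩
  · have h1 := hp n 1 (Pi.single i 1)
    have h2 := hp 1 (ι n) (Pi.single i 1)
    rw [← h1]
    rw [map_one] at h2
    rw [← h2]
    congr 1
    funext k
    by_cases hk : k = i
    · subst hk; simp
    · simp [hk]
  · have h1 := congrFun (hq n (ι n') (tmul ι m 1)) i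
    simp only [bimul_tmul, one_mul] at h1
    simp only [LinearMap.comp_apply, LinearMap.flip_apply, tmulBilin_apply, LinearMap.proj_apply]
    -- Right `N`-linearity: `n'` crosses the tensor sign, since `m ⊗ n' = m n' ⊗ 1`.
    rw [← h1, ← mul_one (ι n'), ← tmul_balanced, mul_one]
  · have h1 : ∀ v : Fin s → M, p v = ∑ i, bimul ι 1 (v i) (p (Pi.single i 1)) := by
      intro v
      have h2 : v = ∑ i, Pi.single i (v i) := (Finset.univ_sum_single v).symm
      conv_lhs => rw [h2]
      rw [map_sum]
      refine Finset.sum_congr rfl fun i _ => ?_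
      have h3 := hp 1 (v i) (Pi.single i 1)
      rw [map_one] at h3
      rw [← h3]
      congr 1
      funext k
      by_cases hk : k = i
      · subst hk; simp
      · simp [hk]
    have h4 := h1 (q (tmul ι m 1))
    rw [← LinearMap.comp_apply, hpq, LinearMap.id_apply] at h4
    exact h4.symm

theorem IsRightDepthTwo.exists_quasibasis (h : IsRightDepthTwo ι) :
    ∃ (s : ℕ) (c : Fin s → B ι) (γ : Fin s → A ι), IsRightQuasibasis c γ := by
  obtain ⟨s, -, p, q, hp, hq, hpq⟩ := h
  refine ⟨s, fun i => ⟨p (Pi.single i 1), fun n => ?_⟩, fun i =>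
    ⟨LinearMap.proj i ∘ₗ q ∘ₗ tmulBilin ι 1, fun n n' m => ?_⟩, fun m => ?_⟩
  · have h1 := hp (ι n) 1 (Pi.single i 1)
    have h2 := hp 1 n (Pi.single i 1)
    rw [map_one] at h1
    rw [← h1, ← h2]
    congr 1
    funext k
    by_cases hk : k = i
    · subst hk; simp
    · simp [hk]
  · have h1 := congrFun (hq (ι n) n' (tmul ι 1 m)) i
    simp only [bimul_tmul, mul_one] at h1
    simp only [LinearMap.comp_apply, tmulBilin_apply, LinearMap.proj_apply]
    rw [← h1, ← one_mul (ι n), tmul_balanced, one_mul, mul_assoc]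
  · have h1 : ∀ v : Fin s → M, p v = ∑ i, bimul ι (v i) 1 (p (Pi.single i 1)) := by
      intro v
      have h2 : v = ∑ i, Pi.single i (v i) := (Finset.univ_sum_single v).symm
      conv_lhs => rw [h2]
      rw [map_sum]
      refine Finset.sum_congr rfl fun i _ => ?_
      have h3 := hp (v i) 1 (Pi.single i 1)
      rw [map_one] at h3
      rw [← h3]
      congr 1
      funext k
      by_cases hk : k = i
      · subst hk; simp
      · simp [hk]
    have h4 := h1 (q (tmul ι 1 m))
    rw [← LinearMap.comp_apply, hpq, LinearMap.id_apply] at h4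
    exact h4.symm

/-! ### Consequences of a left quasibasis, and finite dimension of `A` and `B`. -/

section LeftQuasibasis

variable {s : ℕ} {b : Fin s → B ι} {β : Fin s → A ι} (hb : IsLeftQuasibasis b β)
include hb

/-- The basic contraction, read as `a₍₁₎(m) a₍₂₎(x) = a(m x)`: it is the quasibasis equation at `x`
under `u ⊗ v ↦ a(m u) v`. -/
theorem IsLeftQuasibasis.sum_coactFun_mul (a : A ι) (m x : M) :
    ∑ i, coactFun a m (b i).1 * (β i).1 x = a.1 (m * x) := by
  have h := congrArg (coactFun a m) (hb x)
  rw [map_sum, coactFun_tmul, mul_one] at h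
  rw [← h]
  exact Finset.sum_congr rfl fun i _ => by rw [coactFun_bimul, mul_one]

theorem IsLeftQuasibasis.sum_bimul (x w : M) :
    ∑ i, bimul ι 1 ((β i).1 x * w) (b i).1 = tmul ι x w := by
  have h := congrArg (bimul ι 1 w) (hb x)
  rw [map_sum, bimul_tmul, one_mul, one_mul] at h
  rw [← h]
  exact Finset.sum_congr rfl fun i _ => by rw [bimul_bimul, mul_one]

theorem IsLeftQuasibasis.sum_rightApply_coact_mul (a : A ι) (w : M) (z : TensorSq ι) :
    ∑ i, rightApply (coact a (b i)) z * (β i).1 w = rightApply a (bimul ι 1 w z) := by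
  induction z using tensorSq_induction with
  | zero => simp
  | tmul u v =>
    simp only [rightApply_tmul, coact_apply, mul_assoc, ← Finset.mul_sum, bimul_tmul, one_mul,
      hb.sum_coactFun_mul]
  | add z z' h h' => simp only [map_add, add_mul, Finset.sum_add_distrib, h, h']

/-- The basic contraction at `m = 1`; it shows that the `β_i` generate `A` as a left `R`-module. -/
theorem IsLeftQuasibasis.sum_lambda_mul (a : A ι) :
    ∑ i, lambda (evalOne ι (coact a (b i))) * β i = a :=
  A_ext fun m => by
    simpa using hb.sum_coactFun_mul a 1 m

theorem IsLeftQuasibasis.sum_bimulB (c : B ι) :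
    ∑ i, bimulB 1 (pairingR ι (mapLeftB (β i) c) 1) (b i) = c := by
  refine Subtype.ext ?_
  rw [Submodule.coe_sum]
  simp only [bimulB_val, pairingR_val, mapLeftB_val, OneMemClass.coe_one]
  generalize c.1 = z
  induction z using tensorSq_induction with
  | zero => simp [bimul_zero_right]
  | tmul u v => simpa using hb.sum_bimul u v
  | add z z' h h' => simp only [map_add, bimul_add_right, Finset.sum_add_distrib, h, h']

theorem IsLeftQuasibasis.finiteDimensional_A [FiniteDimensional K (R ι)] :
    FiniteDimensional K (A ι) := by
  let F : (Fin s → R ι) →ₗ[K] A ι :=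
    ∑ i, LinearMap.mulRight K (β i) ∘ₗ lambdaHom ι ∘ₗ LinearMap.proj i
  refine Module.Finite.of_surjective F fun a => ⟨fun i => evalOne ι (coact a (b i)), ?_⟩
  simpa [F] using hb.sum_lambda_mul a

theorem IsLeftQuasibasis.finiteDimensional_B [FiniteDimensional K (R ι)] :
    FiniteDimensional K (B ι) := by
  let F : (Fin s → R ι) →ₗ[K] B ι := ∑ i, bimulBRight (b i) ∘ₗ LinearMap.proj i
  refine Module.Finite.of_surjective F fun c => ⟨fun i => pairingR ι (mapLeftB (β i) c) 1, ?_⟩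
  simpa [F] using hb.sum_bimulB c

end LeftQuasibasis

/-! Index-one Frobenius coordinates -/

section Frobenius

variable {t : ℕ} {φ : R ι →ₗ[K] K} {e f : Fin t → R ι} (h : IsIndexOneFrobenius φ e f)
include h

theorem IsIndexOneFrobenius.sum_left {P : Type*} [AddCommGroup P] [Module K P]
    (G : R ι →ₗ[K] P) (r : R ι) : ∑ j, φ (r * e j) • G (f j) = G r := by
  simpa using congrArg G (h.left r)

theorem IsIndexOneFrobenius.sum_right {P : Type*} [AddCommGroup P] [Module K P]
    (G : R ι →ₗ[K] P) (r : R ι) : ∑ j, φ (f j * r) • G (e j) = G r := by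
  simpa using congrArg G (h.right r)

/-- The one form in which index one enters the construction of the weak Hopf structures. -/
theorem IsIndexOneFrobenius.sum_mul_val (x y : M) :
    ∑ j, (x * (e j).1) * ((f j).1 * y) = x * y := by
  have h1 := congrArg Subtype.val h.index_one
  rw [AddSubmonoidClass.coe_finsetSum] at h1
  simp only [mul_assoc, ← Finset.mul_sum]
  simp only [← mul_assoc (e _).1, ← Finset.sum_mul]
  have h2 : ∑ i, (e i).1 * (f i).1 = (1 : M) := h1
  rw [h2, one_mul]

theorem IsIndexOneFrobenius.sum_mul_mul (r r' : R ι) :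
    ∑ j, φ (r * e j) * φ (f j * r') = φ (r * r') :=
  h.sum_left (φ ∘ₗ LinearMap.mulRight K r') r

theorem IsIndexOneFrobenius.eq_zero_left {r : R ι} (hr : ∀ s, φ (r * s) = 0) : r = 0 := by
  rw [← h.left r]; simp [hr]

theorem IsIndexOneFrobenius.eq_zero_right {r : R ι} (hr : ∀ s, φ (s * r) = 0) : r = 0 := by
  rw [← h.right r]; simp [hr]

/-- Replacing `a` by `ρ(r) a` multiplies `b¹ a(b²)` by `r`, so nondegeneracy of `φ` makes the
`R`-valued pairing vanish. The right quasibasis then gives `b = ∑ b¹ γ_j(b²) c_j¹ ⊗ c_j² = 0`. -/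
theorem pairing_injective {s : ℕ} {c : Fin s → B ι} {γ : Fin s → A ι}
    (hc : IsRightQuasibasis c γ) : Function.Injective (pairing (ι := ι) φ) := by
  rw [← LinearMap.ker_eq_bot, LinearMap.ker_eq_bot']
  intro b hb
  have h0 : ∀ a, rightApply a b.1 = 0 := fun a => congrArg Subtype.val
    (h.eq_zero_left (r := pairingR ι b a) fun r => by
      rw [← pairingR_rho_mul]; exact LinearMap.congr_fun hb _)
  have key : ∀ z : TensorSq ι, ∑ j, bimul ι (rightApply (γ j) z) 1 (c j).1 = z := by
    intro z
    induction z using tensorSq_induction with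
    | zero => simp [bimul_zero_left]
    | tmul u v =>
      have h1 := congrArg (bimul ι u 1) (hc v)
      simpa [bimul_bimul] using h1
    | add z z' h h' => simp only [map_add, bimul_add_left, Finset.sum_add_distrib, h, h']
  refine Subtype.ext ?_
  rw [← key b.1]
  simp [h0, bimul_zero_left]

/-- Here the reconstruction is `a(m) = ∑ γ_j(m) c_j¹ a(c_j²)`. -/
theorem pairing_flip_injective {s : ℕ} {c : Fin s → B ι} {γ : Fin s → A ι}
    (hc : IsRightQuasibasis c γ) : Function.Injective (pairing (ι := ι) φ).flip := by
  rw [← LinearMap.ker_eq_bot, LinearMap.ker_eq_bot']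
  intro a ha
  have h0 : ∀ b : B ι, rightApply a b.1 = 0 := fun b => congrArg Subtype.val
    (h.eq_zero_right (r := pairingR ι b a) fun r => by
      rw [← pairingR_bimulB_left]; exact LinearMap.congr_fun ha _)
  refine A_ext fun m => ?_
  have h1 := congrArg (rightApply a) (hc m)
  rw [map_sum, rightApply_tmul, one_mul] at h1
  rw [← h1]
  refine Finset.sum_eq_zero fun j _ => ?_
  rw [rightApply_bimul, bimul_one_one, LinearMap.id_apply, h0, mul_zero]

theorem pairing_isPerfPair [FiniteDimensional K (A ι)] {s : ℕ} {c : Fin s → B ι}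
    {γ : Fin s → A ι} (hc : IsRightQuasibasis c γ) : (pairing (ι := ι) φ).IsPerfPair :=
  .of_injective' (pairing_injective h hc) (pairing_flip_injective h hc)

end Frobenius

end Extension

section Extension

variable {K N M : Type*} [Field K] [Ring N] [Algebra K N] [Ring M] [Algebra K M] {ι : N →ₐ[K] M}

/-! ### The explicit coproducts are the dual ones, and they are multiplicative. -/

section Coproducts

variable {t : ℕ} {φ : R ι →ₗ[K] K} {e f : Fin t → R ι} (h : IsIndexOneFrobenius φ e f)
include h

/-- The contraction `∑ φ(r e_j) f_j = r` at `r = b¹ X(b²)` nests one pairing inside the other. -/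
theorem sum_pairing_rho_lambda (b b' : B ι) (X Y : A ι) :
    ∑ j, pairing φ b (rho (e j) * X) * pairing φ b' (lambda (f j) * Y) =
      φ (pairingR ι b' (lambda (pairingR ι b X) * Y)) := by
  have h1 := h.sum_left (φ ∘ₗ pairingR ι b' ∘ₗ LinearMap.mulRight K Y ∘ₗ lambdaHom ι)
    (pairingR ι b X)
  simpa [pairing_apply, pairingR_rho_mul] using h1

theorem sum_pairing_bimulB (g g' : B ι) (a a' : A ι) :
    ∑ j, pairing φ (bimulB 1 (e j) g) a * pairing φ (bimulB (f j) 1 g') a' =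
      φ (pairingR ι g (a * rho (pairingR ι g' a'))) := by
  have h1 := h.sum_right (φ ∘ₗ pairingR ι g ∘ₗ LinearMap.mulLeft K a ∘ₗ rhoHom ι)
    (pairingR ι g' a')
  refine Eq.trans (Finset.sum_congr rfl fun j _ => ?_) h1
  rw [pairing_apply, pairing_apply, pairingR_bimulB_left, pairingR_bimulB_right, mul_comm]
  rfl

/-- A sum `∑ X_i ⊗ Y_i` with `∑ X_i(x) Y_i(y) = a(x y)`, multiplied into by the separability
element of `R`, pairs as the coproduct of `a`. -/
theorem pairTensor_sum_rho_lambda {τ : Type*} [Fintype τ] {X Y : τ → A ι} {a : A ι}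
    (ha : ∀ x y, ∑ i, (X i).1 x * (Y i).1 y = a.1 (x * y)) (b b' : B ι) :
    pairTensor (pairing φ) (pairing φ) (b ⊗ₜ b')
      (∑ i, ∑ j, (rho (e j) * X i) ⊗ₜ[K] (lambda (f j) * Y i)) = pairing φ (b * b') a := by
  simp only [map_sum, pairTensor_tmul, sum_pairing_rho_lambda h]
  rw [pairing_apply, ← map_sum]
  congr 1
  refine Subtype.ext ?_
  rw [AddSubmonoidClass.coe_finsetSum]
  simp only [pairingR_val, B_mul_val]
  have h1 : ∀ (u v : M) (z : TensorSq ι),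
      ∑ i, u * (rightApply (X i) z * (Y i).1 v) = rightApply a (bimul ι u v z) := by
    intro u v z
    induction z using tensorSq_induction with
    | zero => simp
    | tmul x y => simp only [rightApply_tmul, bimul_tmul, ← ha, mul_assoc, Finset.mul_sum]
    | add z z' h h' => simp only [map_add, add_mul, mul_add, Finset.sum_add_distrib, h, h']
  -- The identity is linear in `b'` and makes sense on all of `M ⊗_N M`, so it may be tested on pure
  -- tensors, which need not be `N`-central.
  generalize b'.1 = z
  induction z using tensorSq_induction with
  | zero => simp
  | tmul u v => simp [h1]
  | add z z' h h' => simp only [map_add, Finset.sum_add_distrib, h, h']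

variable {s : ℕ} {b : Fin s → B ι} {β : Fin s → A ι} (hb : IsLeftQuasibasis b β)

include hb in
theorem pairTensor_comulA (c c' : B ι) (a : A ι) :
    pairTensor (pairing φ) (pairing φ) (c ⊗ₜ c') (comulA b β e f a) = pairing φ (c * c') a :=
  pairTensor_sum_rho_lambda h (fun x y => hb.sum_coactFun_mul a x y) c c'

include hb in
theorem pairTensor_flip_comulB (a a' : A ι) (c : B ι) :
    pairTensor (pairing φ).flip (pairing φ).flip (a ⊗ₜ a') (comulB b β e f c) =
      (pairing φ).flip (a * a') c := by
  simp only [comulB, map_sum, pairTensor_tmul, LinearMap.flip_apply, sum_pairing_bimulB h]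
  rw [pairing_apply, ← map_sum]
  congr 1
  refine Subtype.ext ?_
  rw [AddSubmonoidClass.coe_finsetSum]
  simp only [pairingR_val, rightApply_mul_rho, mapLeftB_val]
  generalize c.1 = z
  induction z using tensorSq_induction with
  | zero => simp [bimul_zero_right]
  | tmul x y =>
    simp only [mapLeft_tmul, rightApply_tmul, A_mul_apply]
    rw [← map_sum, hb.sum_bimul, rightApply_tmul]
  | add z z' h h' =>
    simp only [map_add, bimul_add_right, Finset.sum_add_distrib, h, h']

variable [FiniteDimensional K (A ι)] [FiniteDimensional K (B ι)]
  [(pairing (ι := ι) φ).IsPerfPair]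

include hb in
-- The right side involves no quasibasis, so the explicit coproduct does not depend on the one
-- chosen.
theorem comulA_eq (a : A ι) : comulA b β e f a = dualComul (pairing φ) a :=
  eq_dualComul _ fun c c' => pairTensor_comulA h hb c c' a

include hb in
theorem comulB_eq (c : B ι) : comulB b β e f c = dualComul (pairing φ).flip c :=
  eq_dualComul _ fun a a' => pairTensor_flip_comulB h hb a a' c

theorem dualComul_pairing_one :
    dualComul (pairing φ) 1 = ∑ j, (rho (e j) : A ι) ⊗ₜ[K] lambda (f j) := by
  refine (eq_dualComul _ fun c c' => ?_).symm
  -- For `a = 1` the single term `1 ⊗ 1` already satisfies `X(x) Y(y) = x y`, so no quasibasis is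
  -- needed.
  have h1 := pairTensor_sum_rho_lambda h (τ := Unit) (X := fun _ => 1) (Y := fun _ => 1)
    (a := 1) (by simp) c c'
  simpa using h1

include hb in
theorem dualComul_pairing_mul (a a' : A ι) : dualComul (pairing φ) (a * a') =
    dualComul (pairing φ) a * dualComul (pairing φ) a' := by
  refine (eq_dualComul _ fun c c' => ?_).symm
  -- The product `Δ(a) Δ(a')` already has the shape `∑ ρ(e_j) X ⊗ λ(f_j) Y`: the outer `e_j, f_j`
  -- come from `Δ(a)`, and those of `Δ(a')` stay inside `X` and `Y`. Contracting with the quasibasis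
  -- for `a`, then by index one, then with the quasibasis for `a'`, leaves `a(a'(x y))`.
  have h1 := pairTensor_sum_rho_lambda h (τ := Fin s × Fin s × Fin t)
    (X := fun i => coact a (b i.1) * (rho (e i.2.2) * coact a' (b i.2.1)))
    (Y := fun i => β i.1 * (lambda (f i.2.2) * β i.2.1)) (a := a * a') (fun x y => by
      simp only [Fintype.sum_prod_type, A_mul_apply, coact_apply, rho_apply, lambda_apply]
      rw [Finset.sum_comm]
      have h2 : ∀ k, ∑ i, ∑ l, coactFun a (coactFun a' x (b k).1 * (e l).1) (b i).1 *
          (β i).1 ((f l).1 * (β k).1 y) = a.1 (coactFun a' x (b k).1 * (β k).1 y) := by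
        intro k
        rw [Finset.sum_comm]
        simp only [hb.sum_coactFun_mul]
        rw [← map_sum, h.sum_mul_val]
      simp only [h2]
      rw [← map_sum, hb.sum_coactFun_mul]) c c'
  rw [← h1, ← comulA_eq h hb, ← comulA_eq h hb, comulA, comulA]
  congr 1
  simp only [Fintype.sum_prod_type, Finset.sum_mul, Finset.mul_sum,
    Algebra.TensorProduct.tmul_mul_tmul, mul_assoc]
  conv_rhs => rw [Finset.sum_comm]
  refine Finset.sum_congr rfl fun i _ => ?_
  rw [Finset.sum_comm]

end Coproducts

end Extension

section Extension

variable {K N M : Type*} [Field K] [Ring N] [Algebra K N] [Ring M] [Algebra K M] {ι : N →ₐ[K] M}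

theorem pairing_one_left (φ : R ι →ₗ[K] K) (a : A ι) : pairing φ 1 a = φ (evalOne ι a) := by
  rw [pairing_apply, pairingR_one_left]

theorem rightApply_one_bimul (x y : M) (z : TensorSq ι) :
    rightApply 1 (bimul ι x y z) = x * rightApply 1 z * y := by
  induction z using tensorSq_induction with
  | zero => simp
  | tmul u v => simp [mul_assoc]
  | add z z' h h' => simp only [map_add, h, h', mul_add, add_mul]

theorem pairing_mul_eq_sum {t : ℕ} {φ : R ι →ₗ[K] K} {e f : Fin t → R ι}
    (h : IsIndexOneFrobenius φ e f) {s : ℕ} {b : Fin s → B ι} {β : Fin s → A ι}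
    (hb : IsLeftQuasibasis b β) (c : B ι) (x y : A ι) :
    pairing φ c (x * y) = ∑ i, ∑ j, pairing φ (bimulB 1 (e j) (b i)) x *
      pairing φ (bimulB (f j) 1 (mapLeftB (β i) c)) y := by
  have h1 := pairTensor_flip_comulB h hb x y c
  rw [LinearMap.flip_apply] at h1
  rw [← h1]
  simp only [comulB, map_sum, pairTensor_tmul, LinearMap.flip_apply]

/-! ### Weak multiplicativity of the counits of `A` and `B`. -/

section Counits

variable {t : ℕ} {φ : R ι →ₗ[K] K} {e f : Fin t → R ι} (h : IsIndexOneFrobenius φ e f)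
  {s : ℕ} {b : Fin s → B ι} {β : Fin s → A ι} (hb : IsLeftQuasibasis b β)
  [FiniteDimensional K (A ι)] [FiniteDimensional K (B ι)] [(pairing (ι := ι) φ).IsPerfPair]

include h hb

/-- The sum over `j` merges the two values of `φ`. The basic contraction for `a'` is then used at
the arguments `1, c(1)` in the first identity and `c(1), 1` in the second; both give
`φ(a(a'(c(1))))`. -/
theorem isWeaklyMultiplicativeCounit_pairing :
    IsWeaklyMultiplicativeCounit (pairing (ι := ι) φ) where
  left a a' c := by
    have h1 : ∀ i, ∑ j, φ (evalOne ι (a * (rho (e j) * coact a' (b i)))) *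
        φ (evalOne ι (lambda (f j) * β i * c)) =
        φ (evalOne ι (a * (rho (evalOne ι (β i * c)) * coact a' (b i)))) := by
      intro i
      refine Eq.trans (Finset.sum_congr rfl fun j _ => ?_) (h.sum_right
        (φ ∘ₗ evalOne ι ∘ₗ LinearMap.mulLeft K a ∘ₗ LinearMap.mulRight K (coact a' (b i)) ∘ₗ
          rhoHom ι) (evalOne ι (β i * c)))
      rw [mul_comm, mul_assoc (lambda _), evalOne_lambda_mul]
      rfl
    rw [← comulA_eq h hb, comulA]
    simp only [map_sum, TensorProduct.map_tmul, LinearMap.mul'_apply, LinearMap.comp_apply,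
      LinearMap.mulLeft_apply, LinearMap.mulRight_apply, pairing_one_left, h1]
    rw [← map_sum]
    congr 1
    refine Subtype.ext ?_
    rw [AddSubmonoidClass.coe_finsetSum]
    simp only [evalOne_val, A_mul_apply, rho_apply, coact_apply]
    rw [← map_sum, hb.sum_coactFun_mul, one_mul]
  right a a' c := by
    have h1 : ∀ i, ∑ j, φ (evalOne ι (rho (e j) * coact a' (b i) * c)) *
        φ (evalOne ι (a * (lambda (f j) * β i))) =
        φ (evalOne ι (a * (lambda (evalOne ι (coact a' (b i) * c)) * β i))) := by
      intro i
      refine Eq.trans (Finset.sum_congr rfl fun j _ => ?_) (h.sum_left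
        (φ ∘ₗ evalOne ι ∘ₗ LinearMap.mulLeft K a ∘ₗ LinearMap.mulRight K (β i) ∘ₗ
          lambdaHom ι) (evalOne ι (coact a' (b i) * c)))
      rw [mul_assoc (rho _), evalOne_rho_mul]
      rfl
    rw [← comulA_eq h hb, comulA]
    simp only [map_sum, TensorProduct.map_tmul, LinearMap.mul'_apply, LinearMap.comp_apply,
      LinearMap.mulLeft_apply, LinearMap.mulRight_apply, pairing_one_left, h1]
    rw [← map_sum]
    congr 1
    refine Subtype.ext ?_
    rw [AddSubmonoidClass.coe_finsetSum]
    simp only [evalOne_val, A_mul_apply, lambda_apply, coact_apply]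
    rw [← map_sum, hb.sum_coactFun_mul, mul_one]

theorem isWeaklyMultiplicativeCounit_pairing_flip :
    IsWeaklyMultiplicativeCounit (pairing (ι := ι) φ).flip where
  left a b' c := by
    have h1 : ∀ i, ∑ j, φ (pairingR ι (a * bimulB 1 (e j) (b i)) 1) *
        φ (pairingR ι (bimulB (f j) 1 (mapLeftB (β i) b') * c) 1) =
        φ (pairingR ι (bimulB (pairingR ι (a * b i) 1) 1 (mapLeftB (β i) b') * c) 1) := by
      intro i
      refine Eq.trans (Finset.sum_congr rfl fun j _ => ?_) (h.sum_left
        (φ ∘ₗ (pairingR ι).flip 1 ∘ₗ LinearMap.mulRight K c ∘ₗ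
          bimulBLeft (mapLeftB (β i) b')) (pairingR ι (a * b i) 1))
      rw [pairingR_mul_bimulB_right]
      rfl
    rw [← comulB_eq h hb, comulB]
    simp only [map_sum, TensorProduct.map_tmul, LinearMap.mul'_apply, LinearMap.comp_apply,
      LinearMap.mulLeft_apply, LinearMap.mulRight_apply, LinearMap.flip_apply, pairing_apply, h1]
    rw [← map_sum]
    congr 1
    refine Subtype.ext ?_
    rw [AddSubmonoidClass.coe_finsetSum]
    -- With `rightApply 1` the multiplication map, this is the quasibasis equation at `x` for `z = x
    -- ⊗ y`, acted on by `a`, multiplied out and then multiplied by `y`.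
    have h2 : ∀ z : TensorSq ι, ∑ i, rightApply 1 (actB a (b i).1) *
        rightApply 1 (mapLeft (β i) z) = rightApply 1 (actB a z) := by
      intro z
      induction z using tensorSq_induction with
      | zero => simp
      | tmul x y =>
        have h3 := congrArg (fun z => rightApply 1 (actB a z) * y) (hb x)
        simp only [map_sum, actB_bimul, rightApply_one_bimul, actB_tmul, one_mul, mul_one,
          Finset.sum_mul, mul_assoc] at h3
        simpa [rightApply_one_bimul, mul_assoc] using h3
      | add z z' h h' => simp only [map_add, mul_add, Finset.sum_add_distrib, h, h']
    simp only [pairingR_val, B_mul_val]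
    generalize c.1 = z
    induction z using tensorSq_induction with
    | zero => simp
    | tmul u v =>
      simp only [actB_tmul, B_mul_val, bimulB_val, rightApply_one_bimul, pairingR_val,
        mapLeftB_val, OneMemClass.coe_one, mul_one]
      rw [← Finset.sum_mul, ← Finset.mul_sum, h2]
    | add z z' h h' => simp only [map_add, Finset.sum_add_distrib, h, h']
  right a b' c := by
    have h1 : ∀ i, ∑ j, φ (pairingR ι (bimulB 1 (e j) (b i) * c) 1) *
        φ (pairingR ι (a * bimulB (f j) 1 (mapLeftB (β i) b')) 1) =
        φ (pairingR ι (bimulB 1 (pairingR ι (a * mapLeftB (β i) b') 1) (b i) * c) 1) := by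
      intro i
      refine Eq.trans (Finset.sum_congr rfl fun j _ => ?_) (h.sum_right
        (φ ∘ₗ (pairingR ι).flip 1 ∘ₗ LinearMap.mulRight K c ∘ₗ
          bimulBRight (b i)) (pairingR ι (a * mapLeftB (β i) b') 1))
      rw [pairingR_mul_bimulB_left, mul_comm]
      rfl
    rw [← comulB_eq h hb, comulB]
    simp only [map_sum, TensorProduct.map_tmul, LinearMap.mul'_apply, LinearMap.comp_apply,
      LinearMap.mulLeft_apply, LinearMap.mulRight_apply, LinearMap.flip_apply, pairing_apply, h1]
    rw [← map_sum]
    congr 1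
    refine Subtype.ext ?_
    rw [AddSubmonoidClass.coe_finsetSum]
    have h2 : ∀ z : TensorSq ι, ∑ i, rightApply 1 (b i).1 *
        rightApply 1 (actB a (mapLeft (β i) z)) = rightApply 1 (actB a z) := by
      intro z
      induction z using tensorSq_induction with
      | zero => simp
      | tmul x y =>
        have h3 := congrArg (fun z => rightApply 1 z * rightApply 1 a.1 * y) (hb x)
        simp only [map_sum, rightApply_one_bimul, rightApply_tmul, A_one_apply, one_mul, mul_one,
          Finset.sum_mul, mul_assoc] at h3
        simpa [rightApply_one_bimul, mul_assoc] using h3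
      | add z z' h h' => simp only [map_add, mul_add, Finset.sum_add_distrib, h, h']
    simp only [pairingR_val, B_mul_val]
    generalize c.1 = z
    induction z using tensorSq_induction with
    | zero => simp
    | tmul u v =>
      simp only [actB_tmul, B_mul_val, bimulB_val, rightApply_one_bimul, pairingR_val,
        mapLeftB_val, OneMemClass.coe_one, one_mul]
      rw [← Finset.sum_mul, ← Finset.mul_sum, h2]
    | add z z' h h' => simp only [map_add, Finset.sum_add_distrib, h, h']

end Counits

/-! ### The antipodes as transposes of each other, and their axioms on `A`. -/

section Antipode

variable {t : ℕ} {φ : R ι →ₗ[K] K} {e f : Fin t → R ι}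
  [FiniteDimensional K (A ι)] [FiniteDimensional K (B ι)] [(pairing (ι := ι) φ).IsPerfPair]

/-- The antipode of `A`, defined by `⟨b, S(a)⟩ = φ(a(b¹) b²)`. -/
noncomputable def antipodeA (φ : R ι →ₗ[K] K) [(pairing (ι := ι) φ).IsPerfPair] :
    A ι →ₗ[K] A ι :=
  (pairing (ι := ι) φ).flip.toPerfPair.symm.toLinearMap ∘ₗ ((copairingR ι).compr₂ φ).flip

omit [FiniteDimensional K (A ι)] [FiniteDimensional K (B ι)] in
theorem pairing_antipodeA (b : B ι) (a : A ι) :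
    pairing φ b (antipodeA φ a) = φ (copairingR ι b a) :=
  LinearMap.apply_toPerfPair_flip (pairing φ) _ b

/-- The antipode of `B`, defined by `⟨S(b), a⟩ = φ(a(b¹) b²)`. -/
noncomputable def antipodeB (φ : R ι →ₗ[K] K) [(pairing (ι := ι) φ).IsPerfPair] :
    B ι →ₗ[K] B ι :=
  (pairing (ι := ι) φ).toPerfPair.symm.toLinearMap ∘ₗ (copairingR ι).compr₂ φ

omit [FiniteDimensional K (A ι)] [FiniteDimensional K (B ι)] in
theorem pairing_antipodeB (b : B ι) (a : A ι) :
    pairing φ (antipodeB φ b) a = pairing φ b (antipodeA φ a) := by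
  rw [pairing_antipodeA]
  exact LinearMap.congr_fun (LinearMap.apply_symm_toPerfPair_self (p := pairing φ) _) a

variable (h : IsIndexOneFrobenius φ e f)
include h

theorem dualTargetProj_pairing (a : A ι) :
    dualTargetProj (pairing φ) a = lambda (evalOne ι a) := by
  rw [dualTargetProj, dualComul_pairing_one h]
  simp only [map_sum, TensorProduct.map_tmul, LinearMap.comp_apply, LinearMap.mulRight_apply,
    pairing_one_left, evalOne_rho_mul, LinearMap.id_apply, TensorProduct.lid_tmul]
  exact h.sum_left (lambdaHom ι) _

theorem pairing_dualSourceProj (b : B ι) (a : A ι) :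
    pairing φ b (dualSourceProj (pairing φ) a) =
      φ (evalOne ι (a * lambda (pairingR ι b 1))) := by
  rw [dualSourceProj, dualComul_pairing_one h]
  simp only [map_sum, TensorProduct.map_tmul, LinearMap.comp_apply, LinearMap.mulLeft_apply,
    pairing_one_left, LinearMap.id_apply, TensorProduct.rid_tmul, map_smul]
  refine Eq.trans (Finset.sum_congr rfl fun j _ => ?_) (h.sum_left
    (φ ∘ₗ evalOne ι ∘ₗ LinearMap.mulLeft K a ∘ₗ lambdaHom ι) (pairingR ι b 1))
  rw [pairing_apply, ← mul_one (rho (e j)), pairingR_rho_mul, smul_eq_mul, mul_comm]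
  rfl

variable {s : ℕ} {b : Fin s → B ι} {β : Fin s → A ι} (hb : IsLeftQuasibasis b β)
include hb

omit [FiniteDimensional K (A ι)] [FiniteDimensional K (B ι)] in
theorem pairing_mul_antipodeA (c : B ι) (x y : A ι) :
    pairing φ c (x * antipodeA φ y) = ∑ i, ∑ j, pairing φ (bimulB 1 (e j) (b i)) x *
      φ (copairingR ι (bimulB (f j) 1 (mapLeftB (β i) c)) y) := by
  simp only [pairing_mul_eq_sum h hb, pairing_antipodeA]

omit [FiniteDimensional K (A ι)] [FiniteDimensional K (B ι)] in
-- Here the coordinates `e_j, f_j` of `Δ(c)` disappear: `e_j` comes out on the right of the first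
-- factor and `f_j` on the left of the second. For `x S(y)` they stay inside the arguments of `x`
-- and `y`.
theorem pairing_antipodeA_mul (c : B ι) (x y : A ι) :
    pairing φ c (antipodeA φ x * y) =
      ∑ i, φ (copairingR ι (b i) x * pairingR ι (mapLeftB (β i) c) y) := by
  simp only [pairing_mul_eq_sum h hb, pairing_antipodeA]
  simp only [pairing_apply, copairingR_bimulB_right, pairingR_bimulB_left, h.sum_mul_mul]

omit [FiniteDimensional K (A ι)] [FiniteDimensional K (B ι)] in
-- Both sides pair with `c` to `φ(a(c¹) r c²)`. This reduces the third antipode axiom to the first.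
theorem antipodeA_mul_lambda (a : A ι) (r : R ι) :
    antipodeA φ a * lambda r = antipodeA φ (rho r * a) := by
  refine eq_of_pair_eq (pairing φ) fun c => ?_
  rw [pairing_antipodeA_mul h hb, pairing_antipodeA, ← map_sum]
  congr 1
  refine Subtype.ext ?_
  rw [AddSubmonoidClass.coe_finsetSum]
  simp only [MulMemClass.coe_mul, copairingR_val, pairingR_val, mapLeftB_val]
  generalize c.1 = z
  induction z using tensorSq_induction with
  | zero => simp
  | tmul u v =>
    simp only [mapLeft_tmul, rightApply_tmul, lambda_apply, ← mul_assoc, ← Finset.sum_mul,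
      hb.sum_coactFun_mul, coactFun_tmul, A_mul_apply, rho_apply, one_mul]
  | add z z' h h' => simp only [map_add, mul_add, Finset.sum_add_distrib, h, h']

theorem isDualAntipode_antipodeA : IsDualAntipode (pairing φ) (antipodeA (ι := ι) φ) := by
  have mul_antipode : ∀ a : A ι, LinearMap.mul' K (A ι)
      ((antipodeA φ).lTensor (A ι) (dualComul (pairing φ) a)) = lambda (evalOne ι a) := by
    intro a
    refine eq_of_pair_eq (pairing φ) fun c => ?_
    rw [← comulA_eq h hb, comulA]
    simp only [map_sum, LinearMap.lTensor_tmul, LinearMap.mul'_apply]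
    simp only [pairing_mul_antipodeA h hb, copairingR_lambda_mul]
    -- The indices `k, l` belong to `Δ(a)` and `i, j` to `Δ(c)`; the sum over `l` merges two values
    -- of `φ`.
    have h1 : ∀ k, ∑ l, ∑ i, ∑ j,
        pairing φ (bimulB 1 (e j) (b i)) (rho (e l) * coact a (b k)) *
          φ (f l * copairingR ι (bimulB (f j) 1 (mapLeftB (β i) c)) (β k)) =
        ∑ i, ∑ j, φ (pairingR ι (bimulB 1 (e j) (b i)) (coact a (b k)) *
          copairingR ι (bimulB (f j) 1 (mapLeftB (β i) c)) (β k)) := by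
      intro k
      rw [Finset.sum_comm]
      refine Finset.sum_congr rfl fun i _ => ?_
      rw [Finset.sum_comm]
      refine Finset.sum_congr rfl fun j _ => ?_
      simp only [pairing_apply, pairingR_rho_mul, h.sum_mul_mul]
    simp only [h1]
    simp only [pairing_apply, ← map_sum φ]
    congr 1
    refine Subtype.ext ?_
    simp only [AddSubmonoidClass.coe_finsetSum, MulMemClass.coe_mul, pairingR_val, copairingR_val,
      bimulB_val, mapLeftB_val, OneMemClass.coe_one]
    generalize c.1 = z
    induction z using tensorSq_induction with
    | zero => simp
    | tmul u v =>
      simp only [mapLeft_tmul, rightApply_tmul, lambda_apply, bimul_tmul, coactFun_tmul, one_mul,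
        mul_one, evalOne_val, ← mul_assoc, ← Finset.sum_mul]
      rw [Finset.sum_comm]
      -- The quasibasis contraction over `k` brings `e_j` and `f_j` together, and index one removes
      -- them. The remaining sum over `i` gives `u ⊗ 1`.
      have h2 : ∀ i, ∑ k, ∑ j, rightApply (coact a (b k)) (bimul ι 1 (e j).1 (b i).1) *
          (β k).1 ((f j).1 * (β i).1 u) = rightApply a (bimul ι 1 ((β i).1 u * 1) (b i).1) := by
        intro i
        rw [Finset.sum_comm]
        simp only [hb.sum_rightApply_coact_mul, bimul_bimul, one_mul]
        rw [← map_sum, ← bimul_sum_right]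
        have h3 := h.sum_mul_val 1 ((β i).1 u)
        simp only [one_mul] at h3
        rw [h3, mul_one]
      simp only [h2]
      rw [← map_sum, hb.sum_bimul, rightApply_tmul]
    | add z z' h h' => simp only [map_add, mul_add, Finset.sum_add_distrib, h, h']
  refine ⟨fun a => ?_, fun a => ?_, fun a => ?_⟩
  · rw [mul_antipode, dualTargetProj_pairing h]
  · refine eq_of_pair_eq (pairing φ) fun c => ?_
    rw [pairing_dualSourceProj h, ← comulA_eq h hb, comulA]
    simp only [map_sum, LinearMap.rTensor_tmul, LinearMap.mul'_apply]
    simp only [pairing_antipodeA_mul h hb, ← map_sum φ]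
    congr 1
    refine Subtype.ext ?_
    simp only [AddSubmonoidClass.coe_finsetSum, MulMemClass.coe_mul, pairingR_val, copairingR_val,
      mapLeftB_val, evalOne_val, A_mul_apply, lambda_apply, mul_one]
    generalize c.1 = z
    induction z using tensorSq_induction with
    | zero => simp
    | tmul u v =>
      simp only [mapLeft_tmul, rightApply_tmul, A_mul_apply, lambda_apply, A_one_apply]
      have h2 : ∀ k, ∑ l, ∑ i, coactFun (rho (e l) * coact a (b k)) 1 (b i).1 *
          ((β i).1 u * ((f l).1 * (β k).1 v)) = coactFun a u (b k).1 * (β k).1 v := by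
        intro k
        simp only [← mul_assoc, ← Finset.sum_mul, hb.sum_coactFun_mul]
        simp only [one_mul, A_mul_apply, rho_apply, coact_apply, Finset.sum_mul]
        simpa only [mul_assoc] using h.sum_mul_val (coactFun a u (b k).1) ((β k).1 v)
      simp only [h2, hb.sum_coactFun_mul]
    | add z z' h h' => simp only [map_add, mul_add, Finset.sum_add_distrib, h, h']
  -- By the first axiom, `S(x₍₁₎) x₍₂₎ S(x₍₃₎) = S(x₍₁₎) λ(x₍₂₎(1)) = S(ρ(x₍₂₎(1)) x₍₁₎)`, and
  -- `x₍₁₎(m) x₍₂₎(1) = x(m)`.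
  · have h1 : LinearMap.mul' K (A ι) ∘ₗ (antipodeA φ).lTensor (A ι) ∘ₗ dualComul (pairing φ) =
        lambdaHom ι ∘ₗ evalOne ι := LinearMap.ext mul_antipode
    rw [h1, ← comulA_eq h hb, comulA]
    simp only [map_sum, TensorProduct.map_tmul, LinearMap.mul'_apply, LinearMap.comp_apply,
      lambdaHom_apply, antipodeA_mul_lambda h hb]
    simp only [← map_sum (antipodeA φ)]
    congr 1
    refine A_ext fun m => ?_
    simp only [A_sum_apply, A_mul_apply, rho_apply, evalOne_val, lambda_apply, coact_apply,
      h.sum_mul_val, hb.sum_coactFun_mul, mul_one]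

end Antipode

/-! ### Frobenius homomorphisms as nondegenerate integrals. -/

section Integral

/-- The element `m ↦ b¹ a(b² m)` of `A`. -/
noncomputable def fourier (a : A ι) (b : B ι) : A ι :=
  ⟨rightApply a ∘ₗ bimulHom b.1 1, fun n n' m => by
    change rightApply a (bimul ι 1 (ι n * m * ι n') b.1) =
      ι n * rightApply a (bimul ι 1 m b.1) * ι n'
    have h1 := congrArg (bimul ι 1 (m * ι n')) (b.2 n)
    simp only [bimul_bimul, one_mul] at h1
    rw [mul_assoc, ← h1, rightApply_bimul, mul_assoc]
    congr 1
    generalize b.1 = z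
    induction z using tensorSq_induction with
    | zero => simp
    | tmul u v => simp [← mul_assoc, A_right]
    | add z z' h h' => simp only [map_add, add_mul, h, h']⟩

theorem fourier_apply (a : A ι) (b : B ι) (m : M) :
    (fourier a b).1 m = rightApply a (bimul ι 1 m b.1) := rfl

/-- Converts nondegeneracy of the form `⟨b c, a⟩` into injectivity of `b ↦ b¹ a(b² -)`. -/
theorem pairingR_fourier (a : A ι) (b c : B ι) :
    pairingR ι c (fourier a b) = pairingR ι (b * c) a := by
  refine Subtype.ext ?_
  simp only [pairingR_val, B_mul_val]
  generalize c.1 = z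
  induction z using tensorSq_induction with
  | zero => simp
  | tmul u v => rw [rightApply_tmul, fourier_apply, actB_tmul, ← rightApply_bimul]
  | add z z' h h' => simp only [map_add, h, h']

/-- The dual bases give the inversion formula `b = ∑ b¹ E(b² x_k) ⊗ y_k`, as `E(b² x_k)` may cross
the tensor sign. -/
theorem fourier_frobeniusElt_injective {E : M →ₗ[K] N} (hE : IsFrobeniusHom ι E) {b : B ι}
    (hb : fourier (frobeniusElt hE) b = 0) : b = 0 := by
  obtain ⟨s, x, y, -, hxy⟩ := hE.dual_bases
  have key : ∀ z : TensorSq ι,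
      ∑ k, tmulBilin ι (rightApply (frobeniusElt hE) (bimul ι 1 (x k) z)) (y k) = z := by
    intro z
    induction z using tensorSq_induction with
    | zero => simp
    | tmul u v =>
      have h1 : ∀ m, (frobeniusElt hE).1 m = ι (E m) := fun m => rfl
      simp only [bimul_tmul, rightApply_tmul, h1, tmulBilin_apply, tmul_balanced, one_mul]
      simp only [← tmulBilin_apply, ← map_sum, hxy]
    | add z z' h h' => simp only [map_add, LinearMap.add_apply, Finset.sum_add_distrib, h, h']
  refine Subtype.ext ?_
  rw [← key b.1]
  have h2 : ∀ m, rightApply (frobeniusElt hE) (bimul ι 1 m b.1) = 0 := fun m => by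
    rw [← fourier_apply, hb]; rfl
  simp [h2]

theorem mul_frobeniusElt {E : M →ₗ[K] N} (hE : IsFrobeniusHom ι E) (a : A ι) :
    a * frobeniusElt hE = lambda (evalOne ι a) * frobeniusElt hE :=
  A_ext fun m => by
    change a.1 (ι (E m)) = a.1 1 * ι (E m)
    rw [← A_right, one_mul]

end Integral

end Extension

universe u

/-! ### Separable algebras are finite-dimensional and semisimple. -/

section Separable

variable {K : Type*} {R : Type u} [Field K] [Ring R] [Algebra K R]

/-- Write `z = ∑ v_i ⊗ c_i` with `v` a basis, and let `V` be the span of the finitely many nonzero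
`c_i`. Comparing coefficients in `r z = z r` gives `c_i r ∈ V`, and `∑ v_i c_i = 1` makes `r ↦ (c_i
r)_i` injective. -/
theorem IsSeparableAlgebra.finiteDimensional (h : IsSeparableAlgebra K R) :
    FiniteDimensional K R := by
  obtain ⟨z, hz1, hz⟩ := h
  let v := Module.Basis.ofVectorSpace K R
  obtain ⟨c, hc⟩ := TensorProduct.eq_repr_basis_left v z
  let V : Submodule K R := Submodule.span K (c '' c.support)
  have hV : ∀ i, c i ∈ V := fun i => by
    by_cases hi : c i = 0
    · rw [hi]; exact zero_mem _
    · exact Submodule.subset_span ⟨i, by simpa using hi, rfl⟩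
  let E : ∀ i, R ⊗[K] R →ₗ[K] R := fun i =>
    (TensorProduct.lid K R).toLinearMap ∘ₗ (v.coord i).rTensor R
  have hE : ∀ i, E i z = c i := by
    intro i
    rw [← hc, Finsupp.sum, map_sum, Finset.sum_eq_single i]
    · simp [E]
    · intro k _ hk; simp [E, hk]
    · intro hi
      simpa [E] using hi
  have hEr : ∀ i (w : R ⊗[K] R) r, E i (w * (1 ⊗ₜ r)) = E i w * r := by
    intro i w r
    induction w with
    | zero => simp
    | add x y hx hy => simp only [add_mul, map_add, hx, hy]
    | tmul x y => simp [E]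
  have hmem : ∀ i r, c i * r ∈ V := by
    intro i r
    rw [← hE, ← hEr, ← hz, ← hc, Finsupp.sum, Finset.mul_sum, map_sum]
    refine Submodule.sum_mem _ fun k _ => ?_
    have : E i ((r ⊗ₜ 1) * (v k ⊗ₜ c k)) = v.coord i (r * v k) • c k := by simp [E]
    rw [this]
    exact V.smul_mem _ (hV k)
  have : FiniteDimensional K V := FiniteDimensional.span_of_finite K (c.support.finite_toSet.image c)
  let F : R →ₗ[K] (c.support → V) :=
    LinearMap.pi fun i => (LinearMap.mulLeft K (c i)).codRestrict V (hmem i)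
  refine Module.Finite.of_injective F ?_
  rw [← LinearMap.ker_eq_bot, LinearMap.ker_eq_bot']
  intro r hr
  have h1 : r = LinearMap.mul' K R z * r := by rw [hz1, one_mul]
  rw [h1, ← hc, Finsupp.sum, map_sum, Finset.sum_mul]
  refine Finset.sum_eq_zero fun i hi => ?_
  have h2 : c i * r = 0 := congrArg Subtype.val (congrFun hr ⟨i, hi⟩)
  rw [LinearMap.mul'_apply, mul_assoc, h2, mul_zero]

theorem IsSeparableAlgebra.isSemisimpleRing (h : IsSeparableAlgebra K R) :
    IsSemisimpleRing R := by
  obtain ⟨z, hz1, hz⟩ := h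
  refine (isSemisimpleModule_iff R R).2 ⟨fun I => ?_⟩
  obtain ⟨p, hp⟩ := LinearMap.exists_leftInverse_of_injective (I.restrictScalars K).subtype
    (Submodule.ker_subtype _)
  -- As in Maschke's theorem, averaging a `K`-linear projection `p` onto `I` to `r ↦ z¹ p(z² r)`
  -- makes it `R`-linear.
  let avg : R → R ⊗[K] R →ₗ[K] R := fun r => LinearMap.mul' K R ∘ₗ
    ((I.restrictScalars K).subtype ∘ₗ p ∘ₗ LinearMap.mulRight K r).lTensor R
  have avg_tmul : ∀ r x y, avg r (x ⊗ₜ y) = x * (p (y * r)).1 := fun r x y => by simp [avg]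
  have h1 : ∀ r s w, avg r ((s ⊗ₜ 1) * w) = s * avg r w := by
    intro r s w
    induction w with
    | zero => simp
    | add x y hx hy => simp only [mul_add, map_add, hx, hy]
    | tmul x y => simp [avg_tmul, mul_assoc]
  have h2 : ∀ r s w, avg r (w * (1 ⊗ₜ s)) = avg (s * r) w := by
    intro r s w
    induction w with
    | zero => simp
    | add x y hx hy => simp only [add_mul, map_add, hx, hy]
    | tmul x y => simp [avg_tmul, mul_assoc]
  have h3 : ∀ r w, avg r w ∈ I := by
    intro r w
    induction w with
    | zero => simp
    | add x y hx hy => rw [map_add]; exact I.add_mem hx hy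
    | tmul x y => rw [avg_tmul]; exact I.smul_mem x (p (y * r)).2
  have h4 : ∀ r ∈ I, ∀ w, avg r w = LinearMap.mul' K R w * r := by
    intro r hr w
    induction w with
    | zero => simp
    | add x y hx hy => simp only [map_add, add_mul, hx, hy]
    | tmul x y =>
      have h5 := LinearMap.congr_fun hp ⟨y * r, I.smul_mem y hr⟩
      simp only [LinearMap.comp_apply, LinearMap.id_apply, Submodule.subtype_apply] at h5
      rw [avg_tmul, h5, LinearMap.mul'_apply, mul_assoc]
  have h6 : ∀ r r' w, avg (r + r') w = avg r w + avg r' w := by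
    intro r r' w
    induction w with
    | zero => simp
    | add x y hx hy => simp only [map_add, hx, hy]; abel
    | tmul x y => simp [avg_tmul, mul_add]
  let q : R →ₗ[R] I :=
    { toFun := fun r => ⟨avg r z, h3 r z⟩
      map_add' := fun r r' => Subtype.ext (h6 r r' z)
      map_smul' := fun s r => Subtype.ext (by
        change avg (s * r) z = s * avg r z
        rw [← h2, ← hz, h1]) }
  exact ⟨LinearMap.ker q, LinearMap.isCompl_of_proj (f := q) fun x => Subtype.ext (by
    change avg x.1 z = x.1
    rw [h4 _ x.2, hz1, one_mul])⟩

end Separable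

/-! ### Central-valued maps attaining `1` at a unit. -/

section UnitsInFibres

/-- Every surjective linear functional over the centre takes the value `1` at a unit. -/
def HasUnitFibres (R : Type*) [Ring R] : Prop :=
  ∀ T : R →+ R, (∀ c, T c ∈ Subring.center R) →
    (∀ ζ ∈ Subring.center R, ∀ c, T (ζ * c) = ζ * T c) → (∃ c, T c = 1) → ∃ c, IsUnit c ∧ T c = 1

/-- `T` cannot vanish on all units, as they generate `R` additively. A nonzero value lies in the
centre, which is a field, and can be scaled to `1`. -/
theorem hasUnitFibres_of_isSimpleRing {R : Type*} [Ring R] [IsSimpleRing R]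
    (h : AddSubgroup.closure {c : R | IsUnit c} = ⊤) : HasUnitFibres R := by
  intro T hT hTl ⟨c0, hc0⟩
  have h1 : ∃ c, IsUnit c ∧ T c ≠ 0 := by
    by_contra! hcon
    have h2 : ∀ c, T c = 0 := by
      intro c
      have hc : c ∈ AddSubgroup.closure {c : R | IsUnit c} := h ▸ AddSubgroup.mem_top c
      induction hc using AddSubgroup.closure_induction with
      | mem x hx => exact hcon x hx
      | zero => exact map_zero T
      | add x y _ _ hx hy => rw [map_add, hx, hy, add_zero]
      | neg x _ hx => rw [map_neg, hx, neg_zero]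
    exact one_ne_zero (hc0.symm.trans (h2 c0))
  obtain ⟨c, hc, hTc⟩ := h1
  obtain ⟨ζ, hζ⟩ := (IsSimpleRing.isField_center R).mul_inv_cancel
    (a := ⟨T c, hT c⟩) (fun h => hTc (congrArg Subtype.val h))
  have hζ1 : T c * ζ.1 = 1 := congrArg Subtype.val hζ
  have hζ2 : ζ.1 * T c = 1 := by rw [← hζ1]; exact (Subring.mem_center_iff.1 (hT c) _)
  exact ⟨ζ.1 * c, IsUnit.mul ⟨⟨ζ.1, T c, hζ2, hζ1⟩, rfl⟩ hc, by rw [hTl _ ζ.2, hζ2]⟩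

theorem closure_isUnit_matrix {n D : Type*} [Fintype n] [DecidableEq n] [DivisionRing D] :
    AddSubgroup.closure {c : Matrix n n D | IsUnit c} = ⊤ := by
  set S := AddSubgroup.closure {c : Matrix n n D | IsUnit c} with hS
  have hunit : ∀ c : Matrix n n D, IsUnit c → c ∈ S := fun c hc => AddSubgroup.subset_closure hc
  have hoff : ∀ i j : n, i ≠ j → ∀ x : D, IsUnit (1 + Matrix.single i j x) := by
    intro i j hij x
    have h : Matrix.single i j x * Matrix.single i j x = 0 :=
      Matrix.single_mul_single_of_ne _ _ _ _ hij.symm _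
    refine ⟨⟨1 + Matrix.single i j x, 1 - Matrix.single i j x, ?_, ?_⟩, rfl⟩
    · rw [mul_sub, mul_one, add_mul, one_mul, h]; abel
    · rw [mul_add, mul_one, sub_mul, one_mul, h]; abel
  have hoff' : ∀ i j : n, i ≠ j → ∀ x : D, Matrix.single i j x ∈ S := by
    intro i j hij x
    have := S.sub_mem (hunit _ (hoff i j hij x)) (hunit 1 isUnit_one)
    simpa using this
  have hsingle : ∀ (i j : n) (x : D), Matrix.single i j x ∈ S := by
    intro i j x
    by_cases hij : i = j
    · subst hij
      by_cases hk : ∃ k, k ≠ i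
      · obtain ⟨k, hk⟩ := hk
        -- `(1 + x E_ik)(1 + E_ki) = 1 + x E_ik + E_ki + x E_ii` reaches the diagonal over every
        -- `D`, including the field with two elements.
        have h1 := hunit _ ((hoff i k hk.symm x).mul (hoff k i hk 1))
        have h2 := S.sub_mem (S.sub_mem (S.sub_mem h1 (hunit 1 isUnit_one))
          (hoff' i k hk.symm x)) (hoff' k i hk 1)
        convert h2 using 1
        rw [add_mul, mul_add, mul_add, Matrix.single_mul_single_same]
        simp only [one_mul, mul_one]
        abel
      · push Not at hk
        by_cases hx : x = 0
        · rw [hx, Matrix.single_zero]; exact S.zero_mem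
        · have hone : (1 : Matrix n n D) = Matrix.single i i 1 := by
            ext a b
            rw [hk a, hk b]; simp
          refine hunit _ ⟨⟨Matrix.single i i x, Matrix.single i i x⁻¹, ?_, ?_⟩, rfl⟩
          · rw [Matrix.single_mul_single_same, mul_inv_cancel₀ hx, hone]
          · rw [Matrix.single_mul_single_same, inv_mul_cancel₀ hx, hone]
    · exact hoff' i j hij x
  refine eq_top_iff.2 fun c _ => ?_
  rw [Matrix.matrix_eq_sum_single c]
  exact S.sum_mem fun i _ => S.sum_mem fun j _ => hsingle i j _

theorem HasUnitFibres.pi {I : Type*} [DecidableEq I] {R : I → Type*}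
    [∀ i, Ring (R i)] (h : ∀ i, HasUnitFibres (R i)) : HasUnitFibres (∀ i, R i) := by
  intro T hT hTl ⟨c0, hc0⟩
  have central : ∀ i (ζ : R i), ζ ∈ Subring.center (R i) →
      (Pi.single i ζ : ∀ i, R i) ∈ Subring.center (∀ i, R i) := by
    intro i ζ hζ
    refine Subring.mem_center_iff.2 fun g => ?_
    funext k
    by_cases hk : k = i
    · subst hk; simpa using Subring.mem_center_iff.1 hζ (g k)
    · simp [hk]
  -- Linearity over the central idempotents splits `T` into its components.
  have comp : ∀ c i, T c i = T (Pi.single i (c i)) i := by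
    intro c i
    have h1 : (Pi.single i (c i) : ∀ i, R i) = Pi.single i 1 * c := by
      rw [← Pi.single_mul_left, one_mul]
    rw [h1, hTl _ (central i 1 (Subring.center (R i)).one_mem)]
    simp
  have h1 : ∀ i, ∃ c : R i, IsUnit c ∧ T (Pi.single i c) i = 1 := by
    intro i
    refine h i ((Pi.evalAddMonoidHom R i).comp (T.comp (AddMonoidHom.single R i)))
      (fun c => ?_) (fun ζ hζ c => ?_) ⟨c0 i, ?_⟩
    · refine Subring.mem_center_iff.2 fun g => ?_
      have h2 := congrFun (Subring.mem_center_iff.1 (hT (Pi.single i c)) (Pi.single i g)) i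
      simpa using h2
    · have h2 := congrFun (hTl _ (central i ζ hζ) (Pi.single i c)) i
      rw [← Pi.single_mul] at h2
      simpa using h2
    · change T (Pi.single i (c0 i)) i = 1
      rw [← comp, hc0]; rfl
  choose u hu hTu using h1
  refine ⟨u, Pi.isUnit_iff.2 hu, ?_⟩
  funext i
  rw [comp, hTu]; rfl

theorem HasUnitFibres.of_ringEquiv {R S : Type*} [Ring R] [Ring S] (e : R ≃+* S)
    (h : HasUnitFibres S) : HasUnitFibres R := by
  intro T hT hTl ⟨c0, hc0⟩
  have hcen : ∀ ζ ∈ Subring.center S, e.symm ζ ∈ Subring.center R := by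
    intro ζ hζ
    refine Subring.mem_center_iff.2 fun g => e.injective ?_
    simpa using Subring.mem_center_iff.1 hζ (e g)
  obtain ⟨c, hc, hTc⟩ := h (e.toAddMonoidHom.comp (T.comp e.symm.toAddMonoidHom))
    (fun c => by
      refine Subring.mem_center_iff.2 fun g => e.symm.injective ?_
      simpa using Subring.mem_center_iff.1 (hT (e.symm c)) (e.symm g))
    (fun ζ hζ c => by
      have := hTl _ (hcen ζ hζ) (e.symm c)
      simpa using congrArg e this)
    ⟨e c0, by simpa using congrArg e hc0⟩
  exact ⟨e.symm c, hc.map e.symm, e.injective (by simpa using hTc)⟩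

end UnitsInFibres

/-! ### Existence of index-one Frobenius coordinates. -/

section Frobenius

variable {K : Type*} {R : Type u} [Field K] [Ring R] [Algebra K R]

theorem exists_nondegenerate_functional [FiniteDimensional K R] [IsSemisimpleRing R] :
    HasUnitFibres R ∧ ∃ φ : R →ₗ[K] K, ∀ r, (∀ s, φ (r * s) = 0) → r = 0 := by
  obtain ⟨n, D, d, _, _, hd, ⟨E⟩⟩ := IsSemisimpleRing.exists_algEquiv_pi_matrix_divisionRing K R
  have hd' : ∀ i, Nonempty (Fin (d i)) := fun i => ⟨⟨0, Nat.pos_of_ne_zero (hd i).out⟩⟩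
  refine ⟨HasUnitFibres.of_ringEquiv E.toRingEquiv (HasUnitFibres.pi fun i =>
    hasUnitFibres_of_isSimpleRing closure_isUnit_matrix), ?_⟩
  -- The functional is the matrix trace followed by some `ψ` with `ψ 1 ≠ 0`; a nonzero entry of `r`
  -- is detected by a matrix unit carrying its inverse.
  have hψ : ∀ i, ∃ ψ : D i →ₗ[K] K, ψ 1 ≠ 0 := by
    intro i
    by_contra! hcon
    exact one_ne_zero ((Module.forall_dual_apply_eq_zero_iff K (1 : D i)).1 hcon)
  choose ψ hψ using hψ
  let Φ : (∀ i, Matrix (Fin (d i)) (Fin (d i)) (D i)) →ₗ[K] K :=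
    ∑ i, ∑ k, ψ i ∘ₗ Matrix.entryLinearMap K (D i) k k ∘ₗ LinearMap.proj i
  have hΦ : ∀ x, Φ x = ∑ i, ∑ k, ψ i (x i k k) := fun x => by simp [Φ]
  refine ⟨Φ ∘ₗ E.toLinearMap, fun r hr => ?_⟩
  apply E.injective
  rw [map_zero]
  funext i
  ext a b
  by_contra hne
  replace hne : E r i a b ≠ 0 := hne
  have h1 := hr (E.symm (Pi.single i (Matrix.single b a (E r i a b)⁻¹)))
  simp only [LinearMap.comp_apply, AlgEquiv.toLinearMap_apply, map_mul, AlgEquiv.apply_symm_apply,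
    hΦ] at h1
  rw [Finset.sum_eq_single i, Finset.sum_eq_single a] at h1
  · rw [Pi.mul_apply, Pi.single_eq_same, Matrix.mul_single_apply_same, mul_inv_cancel₀ hne] at h1
    exact hψ i h1
  · intro k _ hk
    rw [Pi.mul_apply, Pi.single_eq_same, Matrix.mul_single_apply_of_ne _ _ _ _ _ hk, map_zero]
  · simp
  · intro k _ hk
    simp [hk]
  · simp

theorem IsSeparableAlgebra.exists_isIndexOneFrobenius (h : IsSeparableAlgebra K R) :
    ∃ (t : ℕ) (φ : R →ₗ[K] K) (e f : Fin t → R), IsIndexOneFrobenius φ e f := by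
  have := h.finiteDimensional
  have := h.isSemisimpleRing
  obtain ⟨hfib, φ, hφ⟩ := exists_nondegenerate_functional (K := K) (R := R)
  let F : R →ₗ[K] R →ₗ[K] K := (LinearMap.mul K R).compr₂ φ
  have hF : Function.Injective F := by
    rw [← LinearMap.ker_eq_bot, LinearMap.ker_eq_bot']
    exact fun r hr => hφ r fun s => LinearMap.congr_fun hr s
  have hFp : F.IsPerfPair := LinearMap.IsPerfPair.of_bijective F ⟨hF,
    (LinearMap.injective_iff_surjective_of_finrank_eq_finrank
      (Subspace.dual_finrank_eq (K := K) (V := R)).symm).1 hF⟩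
  let v := Module.finBasis K R
  let e : Fin (Module.finrank K R) → R := fun j => F.flip.toPerfPair.symm (v.coord j)
  have he : ∀ r j, φ (r * e j) = v.coord j r := fun r j =>
    LinearMap.apply_toPerfPair_flip F (v.coord j) r
  have left : ∀ r, ∑ j, φ (r * e j) • v j = r := fun r => by
    simp only [he, Module.Basis.coord_apply, v.sum_repr]
  have right : ∀ r, ∑ j, φ (v j * r) • e j = r := fun r => by
    refine eq_of_pair_eq F fun x => ?_
    rw [map_sum]
    have h1 : ∀ j, F x (φ (v j * r) • e j) = φ ((φ (x * e j) • v j) * r) := fun j => by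
      rw [map_smul, smul_mul_assoc, map_smul, smul_eq_mul, smul_eq_mul, mul_comm]
      rfl
    simp only [h1]
    rw [← map_sum, ← Finset.sum_mul, left]
    rfl
  -- Expanding `r e_j` in the `e_k` and `v_k r` in the `v_j` produces the same coefficients `φ(v_k r
  -- e_j)`.
  have casimir : ∀ r c, ∑ j, r * (e j * c * v j) = ∑ j, e j * c * v j * r := by
    intro r c
    have h1 : ∀ j, r * (e j * c * v j) = ∑ k, φ (v k * r * e j) • (e k * c * v j) := fun j => by
      conv_lhs => rw [← mul_assoc, ← mul_assoc, ← right (r * e j)]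
      simp only [Finset.sum_mul, smul_mul_assoc, mul_assoc]
    have h2 : ∀ k, e k * c * v k * r = ∑ j, φ (v k * r * e j) • (e k * c * v j) := fun k => by
      conv_lhs => rw [mul_assoc, ← left (v k * r)]
      simp only [Finset.mul_sum, mul_smul_comm]
    simp only [h1, h2]
    exact Finset.sum_comm
  let T : R →+ R :=
    { toFun := fun c => ∑ j, e j * c * v j
      map_zero' := by simp
      map_add' := fun c c' => by simp [mul_add, add_mul, Finset.sum_add_distrib] }
  have hT : ∀ c, T c = ∑ j, e j * c * v j := fun _ => rfl
  obtain ⟨z, hz1, hz⟩ := h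
  let G : (R →ₗ[K] K) → R ⊗[K] R →ₗ[K] R := fun g =>
    (TensorProduct.lid K R).toLinearMap ∘ₗ g.rTensor R
  have hG1 : ∀ w : R ⊗[K] R, LinearMap.mul' K R w =
      ∑ j, e j * G (φ ∘ₗ LinearMap.mulLeft K (v j)) w := by
    intro w
    induction w with
    | zero => simp
    | add x y hx hy => simp only [map_add, mul_add, Finset.sum_add_distrib, hx, hy]
    | tmul x y =>
      conv_lhs => rw [LinearMap.mul'_apply, ← right x]
      simp [G, Finset.sum_mul]
  have hG2 : ∀ r (w : R ⊗[K] R), G (φ ∘ₗ LinearMap.mulLeft K r) w = G φ ((r ⊗ₜ 1) * w) := by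
    intro r w
    induction w with
    | zero => simp
    | add x y hx hy => simp only [map_add, mul_add, hx, hy]
    | tmul x y => simp [G]
  have hG3 : ∀ r (w : R ⊗[K] R), G φ (w * (1 ⊗ₜ r)) = G φ w * r := by
    intro r w
    induction w with
    | zero => simp
    | add x y hx hy => simp only [map_add, add_mul, hx, hy]
    | tmul x y => simp [G]
  obtain ⟨c, ⟨u, rfl⟩, hc⟩ := hfib T
    (fun c => Subring.mem_center_iff.2 fun r => by
      rw [hT, Finset.mul_sum, Finset.sum_mul, casimir])
    (fun ζ hζ c => by
      rw [hT, hT, Finset.mul_sum]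
      refine Finset.sum_congr rfl fun j _ => ?_
      rw [← mul_assoc (e j), Subring.mem_center_iff.1 hζ (e j)]
      simp only [mul_assoc])
    -- With `c = φ(z¹) z²`, expanding `z¹ = ∑ φ(v_j z¹) e_j` and using `v_j z = z v_j` gives `1 = z¹
    -- z² = ∑ e_j c v_j`.
    ⟨G φ z, by
      rw [hT, ← hz1, hG1]
      refine Finset.sum_congr rfl fun j _ => ?_
      rw [hG2, hz, hG3, mul_assoc]⟩
  -- Twisting `φ` by `u⁻¹` and `e_j` by `u` keeps the bases dual and turns the index into `∑ e_j u
  -- v_j = 1`.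
  refine ⟨_, φ ∘ₗ LinearMap.mulRight K (u⁻¹ : Rˣ).1, fun j => e j * u, v, ?_, ?_, hc⟩
  · intro r
    simpa [mul_assoc] using left r
  · intro r
    have h1 := congrArg (· * u.1) (right (r * (u⁻¹ : Rˣ).1))
    simpa [Finset.sum_mul, mul_assoc] using h1

end Frobenius

end DepthTwo

theorem mainTheorem11 {K N M : Type*} [Field K] [Ring N] [Algebra K N] [Ring M] [Algebra K M]
    (ι : N →ₐ[K] M) (hD2 : IsDepthTwo ι) (hFrob : IsFrobeniusExtension ι)
    (hSep : IsSeparableAlgebra K (DepthTwo.R ι)) :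
    FiniteDimensional K (DepthTwo.A ι) ∧ FiniteDimensional K (DepthTwo.B ι) ∧
    (∃ (s : ℕ) (b : Fin s → DepthTwo.B ι) (β : Fin s → DepthTwo.A ι), IsLeftQuasibasis b β) ∧
    (∃ (t : ℕ) (φ : DepthTwo.R ι →ₗ[K] K) (e f : Fin t → DepthTwo.R ι),
      IsIndexOneFrobenius φ e f) ∧
    ∀ (t : ℕ) (φ : DepthTwo.R ι →ₗ[K] K) (e f : Fin t → DepthTwo.R ι),
      IsIndexOneFrobenius φ e f →
      ∃ (_ : WeakHopfAlgebra K (DepthTwo.A ι)) (_ : WeakHopfAlgebra K (DepthTwo.B ι)),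
        (∀ (s : ℕ) (b : Fin s → DepthTwo.B ι) (β : Fin s → DepthTwo.A ι),
          IsLeftQuasibasis b β →
          (∀ a, Coalgebra.comul (R := K) a = comulA b β e f a) ∧
          (∀ c, Coalgebra.comul (R := K) c = comulB b β e f c)) ∧
        (∀ a : DepthTwo.A ι, Coalgebra.counit (R := K) a = φ (evalOne ι a)) ∧
        (∀ c : DepthTwo.B ι, Coalgebra.counit (R := K) c = φ (pairingR ι c 1)) ∧
        IsDualPairing (pairing (ι := ι) φ) ∧
        (∀ (E : M →ₗ[K] N) (hE : IsFrobeniusHom ι E),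
          IsLeftIntegral K (frobeniusElt hE) ∧ IsNondegenerate K (frobeniusElt hE)) := by
  have hR := hSep.finiteDimensional
  obtain ⟨s, b, β, hb⟩ := hD2.1.exists_quasibasis
  obtain ⟨s', c, γ, hc⟩ := hD2.2.exists_quasibasis
  have hA : FiniteDimensional K (DepthTwo.A ι) := hb.finiteDimensional_A
  have hB : FiniteDimensional K (DepthTwo.B ι) := hb.finiteDimensional_B
  refine ⟨hA, hB, ⟨s, b, β, hb⟩, hSep.exists_isIndexOneFrobenius, fun t φ e f h => ?_⟩
  have hp : (pairing (ι := ι) φ).IsPerfPair := pairing_isPerfPair h hc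
  have hmul := dualComul_pairing_mul h hb
  have hcA := isWeaklyMultiplicativeCounit_pairing h hb
  have hcB := isWeaklyMultiplicativeCounit_pairing_flip h hb
  have hS := isDualAntipode_antipodeA h hb
  let wA : WeakHopfAlgebra K (DepthTwo.A ι) :=
    dualWeakHopfAlgebra (pairing φ) hmul hcA hcB (antipodeA φ) hS
  -- The same construction for the flipped pairing: the counit conditions exchange roles, and
  -- multiplicativity and the antipode axioms are transposed from `A`.
  let wB : WeakHopfAlgebra K (DepthTwo.B ι) :=
    dualWeakHopfAlgebra (pairing φ).flip (dualComul_mul_of_flip (pairing φ).flip hmul) hcB hcA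
      (antipodeB φ) (hS.flip (pairing φ) pairing_antipodeB)
  refine ⟨wA, wB, fun s b β hb => ⟨fun a => (comulA_eq h hb a).symm,
    fun c => (comulB_eq h hb c).symm⟩, fun a => pairing_one_left φ a, fun c => rfl, ?_,
    fun E hE => ⟨fun a => ?_, ?_⟩⟩
  · exact
      { bijective_left := LinearMap.IsPerfPair.bijective_left _
        bijective_right := LinearMap.IsPerfPair.bijective_right _
        mul_left := fun b b' a => by
          rw [← pairTensor_tmul_left]
          exact (pairTensor_dualComul (pairing φ) (b ⊗ₜ b') a).symm
        mul_right := fun b a a' => by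
          rw [← pairTensor_tmul_left]
          exact (pairTensor_dualComul (pairing φ).flip (a ⊗ₜ a') b).symm
        one_left := fun a => rfl
        one_right := fun b => rfl
        antipode := pairing_antipodeB }
  · have h1 : targetProj K a = lambda (evalOne ι a) := dualTargetProj_pairing h a
    rw [h1, mul_frobeniusElt]
  · refine bijective_dualComul_of_pair_mul (pairing φ) (frobeniusElt hE) fun b hb => ?_
    refine fourier_frobeniusElt_injective hE (eq_of_pair_eq (pairing φ) fun c => ?_)
    rw [pairing_apply, pairingR_fourier, ← pairing_apply, hb c, map_zero]
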